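/- Let $\kappa>0$ and $\mathfrak h=\ell^2(\mathbb Z)$ (complex-valued). Let $u$ be the translation $(uf)(x)=f(x-1)$ on $\mathfrak h$, let $h=\mathrm{Re}(u)=\tfrac12(u+u^*)$, let $p_0=(\delta_0,\cdot\,)\,\delta_0$ be the orthogonal projection onto the Kronecker function $\delta_0$, and set $h_B=h+\kappa p_0$. Let the magnetic Hamiltonian be the bounded self-adjoint operator $H_B=h_B\oplus(-h_B)$ on $\mathfrak h\oplus\mathfrak h$. For a bounded self-adjoint operator $A$, denote by $\mathrm{spec}_{ac}(A)$ and $\mathrm{spec}_{sc}(A)$ the spectra of the restrictions of $A$ to its absolutely continuous and its singular continuous subspace, respectively, and by $\mathrm{spec}_{pp}(A)$ the set of eigenvalues of $A$. Then: (a) $\mathrm{spec}_{sc}(H_B)=\emptyset$. (b) $\mathrm{spec}_{ac}(H_B)=[-1,1]$. (c) $\mathrm{spec}_{pp}(H_B)=\{e_B,-e_B\}$ with $e_B=\sqrt{1+\kappa^2}>1$, and both eigenvalues $\pm e_B$ are simple. Let $$f_B(x)=\frac1{n_B}\,e^{-\lambda_B|x|}\quad(x\in\mathbb Z),\qquad \lambda_B=\log(\kappa+e_B)>0,\qquad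 n_B=\sqrt{e_B/\kappa}.$$ Then $f_B\in\mathfrak h$, the vector $f_B\oplus 0$ is a normalized eigenvector of $H_B$ with eigenvalue $e_B$, and $0\oplus f_B$ is a normalized eigenvector of $H_B$ with eigenvalue $-e_B$. -/

import Mathlib

open MeasureTheory
open scoped CompactlySupported

noncomputable section

namespace SpectralTypes

variable {H : Type*} [NormedAddCommGroup H] [InnerProductSpace ℂ H] [CompleteSpace H]

/-- The positive linear functional `f ↦ ⟪ψ, f(A) ψ⟫` on the compactly supported continuous
functions `f : ℝ → ℝ`, where `f(A)` is the continuous functional calculus of the self-adjoint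
operator `A`. -/
def spectralFunctional (A : H →L[ℂ] H) (ψ : H) : C_c(ℝ, ℝ) →ₚ[ℝ] ℝ :=
  PositiveLinearMap.mk₀
    { toFun := fun f => (inner ℂ ψ (cfc (fun x : ℝ => f x) A ψ)).re
      map_add' := fun f g => by
        have h : cfc (fun x : ℝ => (f + g) x) A
            = cfc (fun x : ℝ => f x) A + cfc (fun x : ℝ => g x) A :=
          cfc_add (a := A) (fun x : ℝ => f x) (fun x : ℝ => g x)
            f.continuous.continuousOn g.continuous.continuousOn
        rw [h]
        simp
      map_smul' := fun c f => by
        have h : cfc (fun x : ℝ => (c • f) x) A = c • cfc (fun x : ℝ => f x) A :=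
          cfc_smul c (fun x : ℝ => f x) A f.continuous.continuousOn
        rw [h, smul_apply, ← Complex.coe_smul, inner_smul_right]
        simp }
    fun f hf => by
      have h : 0 ≤ cfc (fun x : ℝ => f x) A := cfc_nonneg fun x _ => hf x
      exact ((ContinuousLinearMap.nonneg_iff_isPositive _).1 h).re_inner_nonneg_right ψ

/-- The spectral measure of the self-adjoint operator `A` in the vector `ψ`: the Borel measure
`μ` on `ℝ` with `∫ f dμ = ⟪ψ, f(A) ψ⟫`. -/
def spectralMeasure (A : H →L[ℂ] H) (ψ : H) : Measure ℝ :=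
  RealRMK.rieszMeasure (spectralFunctional A ψ)

instance (A : H →L[ℂ] H) (ψ : H) : (spectralMeasure A ψ).Regular := by
  unfold spectralMeasure
  infer_instance

theorem integral_spectralMeasure (A : H →L[ℂ] H) (ψ : H) (f : C_c(ℝ, ℝ)) :
    ∫ x, f x ∂(spectralMeasure A ψ) = (inner ℂ ψ (cfc (fun x : ℝ => f x) A ψ)).re :=
  RealRMK.integral_rieszMeasure _ f

theorem finiteOnCompacts_add (μ ν : Measure ℝ) [IsFiniteMeasureOnCompacts μ]
    [IsFiniteMeasureOnCompacts ν] : IsFiniteMeasureOnCompacts (μ + ν) where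
  lt_top_of_isCompact _ hK := by
    rw [Measure.add_apply]
    exact ENNReal.add_lt_top.2 ⟨hK.measure_lt_top, hK.measure_lt_top⟩

theorem spectralMeasure_parallelogram (A : H →L[ℂ] H) (φ ψ : H) :
    spectralMeasure A (φ + ψ) + spectralMeasure A (φ - ψ)
      = (spectralMeasure A φ + spectralMeasure A ψ)
        + (spectralMeasure A φ + spectralMeasure A ψ) := by
  have h₁ := finiteOnCompacts_add (spectralMeasure A (φ + ψ)) (spectralMeasure A (φ - ψ))
  have h₂ := finiteOnCompacts_add (spectralMeasure A φ) (spectralMeasure A ψ)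
  have h₃ := finiteOnCompacts_add (spectralMeasure A φ + spectralMeasure A ψ)
    (spectralMeasure A φ + spectralMeasure A ψ)
  apply Measure.ext_of_integral_eq_on_compactlySupported
  intro f
  rw [integral_add_measure f.integrable f.integrable,
    integral_add_measure f.integrable f.integrable,
    integral_add_measure f.integrable f.integrable]
  simp only [integral_spectralMeasure, map_add, map_sub, inner_add_left, inner_add_right,
    inner_sub_left, inner_sub_right, Complex.add_re, Complex.sub_re]
  ring

theorem spectralMeasure_add_le (A : H →L[ℂ] H) (φ ψ : H) :
    spectralMeasure A (φ + ψ)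
      ≤ (spectralMeasure A φ + spectralMeasure A ψ)
        + (spectralMeasure A φ + spectralMeasure A ψ) := by
  rw [← spectralMeasure_parallelogram]
  exact Measure.le_add_right le_rfl

theorem spectralMeasure_smul (A : H →L[ℂ] H) (c : ℂ) (ψ : H) :
    spectralMeasure A (c • ψ) = (‖c‖₊ ^ 2) • spectralMeasure A ψ := by
  have : ((‖c‖₊ ^ 2) • spectralMeasure A ψ).Regular := Measure.Regular.smul_nnreal _
  apply Measure.ext_of_integral_eq_on_compactlySupported
  intro f
  rw [integral_smul_nnreal_measure, integral_spectralMeasure, integral_spectralMeasure, map_smul,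
    inner_smul_left, inner_smul_right, ← mul_assoc, ← Complex.normSq_eq_conj_mul_self,
    Complex.re_ofReal_mul, Complex.normSq_eq_norm_sq, NNReal.smul_def]
  simp

theorem spectralMeasure_zero (A : H →L[ℂ] H) : spectralMeasure A 0 = 0 := by
  simpa using spectralMeasure_smul A 0 0

theorem spectralMeasure_apply (A : H →L[ℂ] H) (hA : IsSelfAdjoint A) (ψ : H) :
    spectralMeasure A (A ψ)
      = (spectralMeasure A ψ).withDensity (fun x => ENNReal.ofReal (x ^ 2)) := by
  have : IsLocallyFiniteMeasure
      ((spectralMeasure A ψ).withDensity (fun x => ENNReal.ofReal (x ^ 2))) :=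
    IsLocallyFiniteMeasure.withDensity_ofReal (by fun_prop)
  apply Measure.ext_of_integral_eq_on_compactlySupported
  intro f
  have hd : ∫ x, f x ∂((spectralMeasure A ψ).withDensity (fun x => ENNReal.ofReal (x ^ 2)))
      = ∫ x, x ^ 2 * f x ∂(spectralMeasure A ψ) := by
    rw [integral_withDensity_eq_integral_toReal_smul (by fun_prop) (by simp)]
    refine integral_congr_ae (Filter.Eventually.of_forall fun x => ?_)
    simp [ENNReal.toReal_ofReal (sq_nonneg x)]
  have hc : Continuous (fun x : ℝ => x ^ 2 * f x) := (continuous_id.pow 2).mul f.continuous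
  have hcs : HasCompactSupport (fun x : ℝ => x ^ 2 * f x) := f.hasCompactSupport.mul_left
  let g : C_c(ℝ, ℝ) := ⟨⟨fun x => x ^ 2 * f x, hc⟩, hcs⟩
  have hg : cfc (fun x : ℝ => g x) A = A * cfc (fun x : ℝ => f x) A * A := by
    have hf : ContinuousOn (fun x : ℝ => f x) (spectrum ℝ A) := f.continuous.continuousOn
    have e : (fun x : ℝ => g x) = fun x : ℝ => (x * f x) * x := by
      funext x
      change x ^ 2 * f x = _
      ring
    rw [e, cfc_mul (fun x : ℝ => x * f x) (fun x => x) A (by fun_prop) (by fun_prop),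
      cfc_mul (fun x : ℝ => x) (fun x => f x) A (by fun_prop) hf, cfc_id' ℝ A]
  have hgi := integral_spectralMeasure A ψ g
  rw [hd, integral_spectralMeasure]
  refine Eq.trans ?_ hgi.symm
  rw [hg]
  have hs : ∀ x y : H, inner ℂ (A x) y = inner ℂ x (A y) := fun x y =>
    hA.isSymmetric x y
  rw [hs]
  rfl

/-- The absolutely continuous subspace: the vectors whose spectral measure is absolutely
continuous with respect to the Lebesgue measure. -/
def acSubspace (A : H →L[ℂ] H) : Submodule ℂ H where
  carrier := {ψ | spectralMeasure A ψ ≪ volume}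
  zero_mem' := by
    change spectralMeasure A 0 ≪ volume
    rw [spectralMeasure_zero]
    exact Measure.AbsolutelyContinuous.zero _
  add_mem' := fun {φ ψ} hφ hψ => by
    refine (spectralMeasure_add_le A φ ψ).absolutelyContinuous.trans ?_
    exact (hφ.add_left hψ).add_left (hφ.add_left hψ)
  smul_mem' := fun c ψ hψ => by
    change spectralMeasure A (c • ψ) ≪ volume
    rw [spectralMeasure_smul]
    exact Measure.AbsolutelyContinuous.smul_left hψ _

/-- The singular continuous subspace: the vectors whose spectral measure has no atoms and is
singular with respect to the Lebesgue measure. -/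
def scSubspace (A : H →L[ℂ] H) : Submodule ℂ H where
  carrier := {ψ | (∀ x : ℝ, spectralMeasure A ψ {x} = 0) ∧ spectralMeasure A ψ ⟂ₘ volume}
  zero_mem' := by
    change (∀ x : ℝ, spectralMeasure A 0 {x} = 0) ∧ spectralMeasure A 0 ⟂ₘ volume
    rw [spectralMeasure_zero]
    exact ⟨fun x => rfl, Measure.MutuallySingular.zero_left⟩
  add_mem' := fun {φ ψ} hφ hψ => by
    refine ⟨fun x => ?_, ?_⟩
    · have h := spectralMeasure_add_le A φ ψ {x}
      simpa [hφ.1 x, hψ.1 x] using h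
    · exact Measure.MutuallySingular.mono
        ((hφ.2.add_left hψ.2).add_left (hφ.2.add_left hψ.2))
        (spectralMeasure_add_le A φ ψ) le_rfl
  smul_mem' := fun c ψ hψ => by
    change (∀ x : ℝ, spectralMeasure A (c • ψ) {x} = 0) ∧ spectralMeasure A (c • ψ) ⟂ₘ volume
    rw [spectralMeasure_smul]
    exact ⟨fun x => by simp [hψ.1 x], hψ.2.smul _⟩

theorem apply_mem_acSubspace (A : H →L[ℂ] H) (hA : IsSelfAdjoint A) :
    ∀ ψ ∈ acSubspace A, A ψ ∈ acSubspace A := by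
  intro ψ hψ
  change spectralMeasure A (A ψ) ≪ volume
  rw [spectralMeasure_apply A hA]
  exact (withDensity_absolutelyContinuous _ _).trans hψ

theorem apply_mem_scSubspace (A : H →L[ℂ] H) (hA : IsSelfAdjoint A) :
    ∀ ψ ∈ scSubspace A, A ψ ∈ scSubspace A := by
  intro ψ hψ
  change (∀ x : ℝ, spectralMeasure A (A ψ) {x} = 0) ∧ spectralMeasure A (A ψ) ⟂ₘ volume
  rw [spectralMeasure_apply A hA]
  exact ⟨fun x => withDensity_absolutelyContinuous _ _ (hψ.1 x),
    hψ.2.mono_ac (withDensity_absolutelyContinuous _ _) Measure.AbsolutelyContinuous.rfl⟩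

/-- The absolutely continuous spectrum of a self-adjoint operator: the spectrum of its
restriction to the absolutely continuous subspace. -/
def specAC (A : H →L[ℂ] H) (hA : IsSelfAdjoint A) : Set ℂ :=
  spectrum ℂ (A.restrict (apply_mem_acSubspace A hA))

/-- The singular continuous spectrum of a self-adjoint operator: the spectrum of its
restriction to the singular continuous subspace. -/
def specSC (A : H →L[ℂ] H) (hA : IsSelfAdjoint A) : Set ℂ :=
  spectrum ℂ (A.restrict (apply_mem_scSubspace A hA))

/-- The pure point spectrum: the set of eigenvalues. -/
def specPP (A : H →L[ℂ] H) : Set ℂ :=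
  {z | Module.End.HasEigenvalue (A : H →ₗ[ℂ] H) z}

end SpectralTypes

namespace MagneticXY

/-- The one-particle Hilbert space `ℓ²(ℤ)`. -/
abbrev OneParticle : Type := lp (fun _ : ℤ => ℂ) 2

/-- The Hilbert space direct sum `ℓ²(ℤ) ⊕ ℓ²(ℤ)`. -/
abbrev Doubled : Type := WithLp 2 (OneParticle × OneParticle)

/-- The vector `f₁ ⊕ f₂` of the direct sum. -/
def directSum (f₁ f₂ : OneParticle) : Doubled := WithLp.toLp 2 (f₁, f₂)

/-- The operator `a ⊕ b` on the direct sum, `(a ⊕ b)(f₁ ⊕ f₂) = a f₁ ⊕ b f₂`. -/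
def directSumOp (a b : OneParticle →L[ℂ] OneParticle) : Doubled →L[ℂ] Doubled :=
  (WithLp.prodContinuousLinearEquiv 2 ℂ OneParticle OneParticle).symm.toContinuousLinearMap ∘L
    (a.prodMap b) ∘L
      (WithLp.prodContinuousLinearEquiv 2 ℂ OneParticle OneParticle).toContinuousLinearMap

@[simp] theorem directSumOp_directSum (a b : OneParticle →L[ℂ] OneParticle)
    (f₁ f₂ : OneParticle) :
    directSumOp a b (directSum f₁ f₂) = directSum (a f₁) (b f₂) := rfl

theorem memlp_shift (f : OneParticle) : Memℓp (fun x : ℤ => (f : ℤ → ℂ) (x - 1)) 2 := by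
  have hf := (memℓp_gen_iff (p := 2) (by norm_num)).1 (lp.memℓp f)
  exact memℓp_gen ((Equiv.subRight (1 : ℤ)).summable_iff.2 hf)

/-- The translation `(u f)(x) = f(x - 1)` on `ℓ²(ℤ)`. -/
def shift : OneParticle →L[ℂ] OneParticle :=
  LinearMap.mkContinuous
    { toFun := fun f => ⟨fun x : ℤ => (f : ℤ → ℂ) (x - 1), memlp_shift f⟩
      map_add' := fun f g => rfl
      map_smul' := fun c f => rfl } 1
    (fun f => by
      rw [one_mul]
      refine lp.norm_le_of_tsum_le (p := 2) (by norm_num) (norm_nonneg f) (le_of_eq ?_)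
      rw [lp.norm_rpow_eq_tsum (by norm_num) f]
      exact (Equiv.subRight (1 : ℤ)).tsum_eq
        (fun x : ℤ => ‖(f : ℤ → ℂ) x‖ ^ (2 : ENNReal).toReal))

@[simp] theorem shift_apply (f : OneParticle) (x : ℤ) :
    (shift f : ℤ → ℂ) x = (f : ℤ → ℂ) (x - 1) := rfl

/-- The real part `Re(a) = (a + a*) / 2` of a bounded operator. -/
def reOp (a : OneParticle →L[ℂ] OneParticle) : OneParticle →L[ℂ] OneParticle :=
  (1 / 2 : ℂ) • (a + ContinuousLinearMap.adjoint a)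

/-- The Kronecker function `δ_x` in `ℓ²(ℤ)`. -/
def delta (x : ℤ) : OneParticle := lp.single 2 x (1 : ℂ)

/-- The rank one projection `p₀ = ⟪δ₀, ·⟫ δ₀`. -/
def proj0 : OneParticle →L[ℂ] OneParticle :=
  InnerProductSpace.rankOne ℂ (delta 0) (delta 0)

/-- The XY one-particle Hamiltonian `h = Re(u)`. -/
def hXY : OneParticle →L[ℂ] OneParticle := reOp shift

/-- The magnetic one-particle Hamiltonian `h_B = h + κ p₀`. -/
def hB (κ : ℝ) : OneParticle →L[ℂ] OneParticle := hXY + (κ : ℂ) • proj0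

/-- The magnetic Hamiltonian `H_B = h_B ⊕ (-h_B)`. -/
def HB (κ : ℝ) : Doubled →L[ℂ] Doubled := directSumOp (hB κ) (-(hB κ))

theorem isSelfAdjoint_hB (κ : ℝ) : IsSelfAdjoint (hB κ) := by
  have h₁ : IsSelfAdjoint (shift + ContinuousLinearMap.adjoint shift) :=
    IsSelfAdjoint.add_star_self shift
  have h₂ : IsSelfAdjoint proj0 := by
    rw [proj0, ContinuousLinearMap.isSelfAdjoint_iff', InnerProductSpace.adjoint_rankOne]
  have h₃ : IsSelfAdjoint (1 / 2 : ℂ) := by simp [isSelfAdjoint_iff]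
  have h₄ : IsSelfAdjoint (κ : ℂ) := by simp [isSelfAdjoint_iff]
  exact (h₃.smul h₁).add (h₄.smul h₂)

theorem isSelfAdjoint_HB (κ : ℝ) : IsSelfAdjoint (HB κ) := by
  rw [ContinuousLinearMap.isSelfAdjoint_iff_isSymmetric]
  have h := (ContinuousLinearMap.isSelfAdjoint_iff_isSymmetric).1 (isSelfAdjoint_hB κ)
  intro F G
  have h₁ : inner ℂ (hB κ F.fst) G.fst = inner ℂ F.fst (hB κ G.fst) := h F.fst G.fst
  have h₂ : inner ℂ (hB κ F.snd) G.snd = inner ℂ F.snd (hB κ G.snd) := h F.snd G.snd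
  change inner ℂ (hB κ F.fst) G.fst + inner ℂ (-(hB κ F.snd)) G.snd
    = inner ℂ F.fst (hB κ G.fst) + inner ℂ F.snd (-(hB κ G.snd))
  rw [inner_neg_left, inner_neg_right, h₁, h₂]

/-- The eigenvalue `e_B = √(1 + κ²)`. -/
def eB (κ : ℝ) : ℝ := Real.sqrt (1 + κ ^ 2)

/-- The decay rate `λ_B = log(κ + e_B)`. -/
def lamB (κ : ℝ) : ℝ := Real.log (κ + eB κ)

/-- The normalization constant `n_B = √(e_B / κ)`. -/
def nB (κ : ℝ) : ℝ := Real.sqrt (eB κ / κ)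

end MagneticXY

end

open SpectralTypes MagneticXY

open MeasureTheory Filter

namespace SpectralTypes

/-! The free operator `h` serves as a purely absolutely continuous model, and everything is
transported from it by bounded intertwiners. If `X h = A X`, then `X f(h) = f(A) X`, so the spectral
measure of `A` in `X ψ` is absolutely continuous with respect to that of `h` in `ψ`. Hence the range
of `X` lies in the absolutely continuous subspace of `A`, and functions of `A` vanishing on the
spectrum of `h` kill it.

For `h_B` two intertwiners suffice. On odd sequences the potential at 0 is invisible, so the odd
projection intertwines. On even sequences a first-order Darboux operator `D` intertwines, and `h_B²
- e_B² = -D D*` there (`hB_sq_sub`). The gauge factor `(-1)ˣ` turns `h` into `-h` and so handles the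
summand `-h_B`. Thus the range of `H_B² - e_B²` is spanned by ranges of intertwiners
(`HB_sq_sub_mem`).

The rest is soft. A singular continuous vector is annihilated by `H_B² - e_B²`, since its image is
both absolutely and singularly continuous; a nonzero one would produce an eigenvector without an
atom. An eigenvector with `z² ≠ e_B²` would lie in the absolutely continuous subspace. A function of
`H_B` vanishing on `[-1,1]` kills that subspace, which gives the resolvent off `[-1,1]`. Conversely,
for `t` in `[-1,1]` an explicit absolutely continuous vector is not in the range of `t - H_B`,
because square-summable solutions of the free recursion vanish. The eigenspaces at `±e_B` come from
the same recursion in the hyperbolic regime. -/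

/-! ### Intertwiners, functional calculus and spectral measures -/

theorem comp_aeval_eq {H K : Type*} [NormedAddCommGroup H] [NormedSpace ℂ H]
    [NormedAddCommGroup K] [NormedSpace ℂ K] {A : H →L[ℂ] H} {B : K →L[ℂ] K} {X : H →L[ℂ] K} (hX : X ∘L A = B ∘L X)
    (p : Polynomial ℝ) :
    X ∘L Polynomial.aeval A p = Polynomial.aeval B p ∘L X := by
  induction p using Polynomial.induction_on with
  | C a =>
    ext v
    simp [Algebra.algebraMap_eq_smul_one]
  | add p q hp hq => simp [ContinuousLinearMap.comp_add, ContinuousLinearMap.add_comp, hp, hq]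
  | monomial n a h =>
    have e : (Polynomial.C a * Polynomial.X ^ (n + 1) : Polynomial ℝ)
        = (Polynomial.C a * Polynomial.X ^ n) * Polynomial.X := by ring
    rw [e, map_mul, map_mul (Polynomial.aeval B), Polynomial.aeval_X, Polynomial.aeval_X]
    change (X ∘L _) ∘L A = _ ∘L (B ∘L X)
    rw [h, ← hX]
    rfl

variable {H K : Type*} [NormedAddCommGroup H] [InnerProductSpace ℂ H] [CompleteSpace H]
  [NormedAddCommGroup K] [InnerProductSpace ℂ K] [CompleteSpace K]

theorem exists_polynomial_near_on_union {s t : Set ℝ} (hs : IsCompact s) (ht : IsCompact t)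
    {f : ℝ → ℝ} (hf : Continuous f) {ε : ℝ} (hε : 0 < ε) :
    ∃ p : Polynomial ℝ, ∀ x ∈ s ∪ t, |p.eval x - f x| ≤ ε := by
  obtain ⟨r, hr⟩ := (hs.union ht).isBounded.subset_closedBall 0
  rw [Real.closedBall_eq_Icc] at hr
  obtain ⟨p, hp⟩ := exists_polynomial_near_of_continuousOn _ _ f hf.continuousOn ε hε
  exact ⟨p, fun x hx => (hp x (hr hx)).le⟩

theorem norm_aeval_sub_cfc_le {A : H →L[ℂ] H} (hA : IsSelfAdjoint A) {f : ℝ → ℝ}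
    (hf : Continuous f) {p : Polynomial ℝ} {ε : ℝ} (hε : 0 ≤ ε)
    (hp : ∀ x ∈ spectrum ℝ A, |p.eval x - f x| ≤ ε) :
    ‖Polynomial.aeval A p - cfc f A‖ ≤ ε := by
  rw [← cfc_polynomial p A, ← cfc_sub _ _ A p.continuous.continuousOn hf.continuousOn]
  exact norm_cfc_le hε hp

/-- An operator intertwining two self-adjoint operators intertwines their functional calculi. -/
theorem comp_cfc_eq {A : H →L[ℂ] H} {B : K →L[ℂ] K} (hA : IsSelfAdjoint A)
    (hB : IsSelfAdjoint B) {X : H →L[ℂ] K} (hX : X ∘L A = B ∘L X) {f : ℝ → ℝ}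
    (hf : Continuous f) : X ∘L cfc f A = cfc f B ∘L X := by
  rw [← sub_eq_zero, ← norm_le_zero_iff]
  refine le_of_forall_pos_le_add fun ε hε => ?_
  -- Replacing each functional calculus by the same polynomial costs at most `δ * ‖X‖`; the `+ 1`
  -- guards against `X = 0`.
  set δ := ε / (2 * (‖X‖ + 1)) with hδ
  have hX0 := norm_nonneg X
  have hδ0 : 0 < δ := by positivity
  obtain ⟨p, hp⟩ := exists_polynomial_near_on_union (ContinuousFunctionalCalculus.isCompact_spectrum A)
    (ContinuousFunctionalCalculus.isCompact_spectrum B) hf hδ0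
  have h₁ := norm_aeval_sub_cfc_le hA hf hδ0.le fun x hx => hp x (Or.inl hx)
  have h₂ := norm_aeval_sub_cfc_le hB hf hδ0.le fun x hx => hp x (Or.inr hx)
  have e : X ∘L cfc f A - cfc f B ∘L X
      = (Polynomial.aeval B p - cfc f B) ∘L X - X ∘L (Polynomial.aeval A p - cfc f A) := by
    rw [ContinuousLinearMap.comp_sub, ContinuousLinearMap.sub_comp, comp_aeval_eq hX]
    abel
  have h₃ := (ContinuousLinearMap.opNorm_comp_le (Polynomial.aeval B p - cfc f B) X)
  have h₄ := (ContinuousLinearMap.opNorm_comp_le X (Polynomial.aeval A p - cfc f A))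
  rw [e]
  calc _ ≤ δ * ‖X‖ + ‖X‖ * δ := by
        refine (norm_sub_le _ _).trans (add_le_add (h₃.trans ?_) (h₄.trans ?_)) <;> gcongr
    _ ≤ δ * (2 * (‖X‖ + 1)) := by nlinarith
    _ = 0 + ε := by rw [hδ]; field_simp; ring

theorem inner_cfc_eq_norm_sq {A : H →L[ℂ] H} (ψ : H) {f : ℝ → ℝ}
    (hf : Continuous f) (hf0 : ∀ x, 0 ≤ f x) :
    (inner ℂ ψ (cfc f A ψ)).re = ‖cfc (fun x => √(f x)) A ψ‖ ^ 2 := by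
  have hs : Continuous fun x => √(f x) := hf.sqrt
  have e : cfc f A = cfc (fun x => √(f x)) A * cfc (fun x => √(f x)) A := by
    rw [← cfc_mul _ _ A hs.continuousOn hs.continuousOn]
    congr 1
    funext x
    exact (Real.mul_self_sqrt (hf0 x)).symm
  have hsa : IsSelfAdjoint (cfc (fun x => √(f x)) A) := cfc_predicate _ _
  have h := hsa.isSymmetric ψ (cfc (fun x => √(f x)) A ψ)
  change inner ℂ (cfc (fun x => √(f x)) A ψ) _ = inner ℂ ψ (cfc (fun x => √(f x)) A _) at h
  rw [e]
  change (inner ℂ ψ (cfc (fun x => √(f x)) A (cfc (fun x => √(f x)) A ψ))).re = _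
  rw [← h, inner_self_eq_norm_sq_to_K]
  norm_cast

/-- Both sides are squared norms of `√f` applied to the vectors, and `X` passes through `√f`. -/
theorem inner_cfc_intertwine_le {A : H →L[ℂ] H} {B : K →L[ℂ] K} (hA : IsSelfAdjoint A)
    (hB : IsSelfAdjoint B) {X : H →L[ℂ] K} (hX : X ∘L A = B ∘L X) {f : ℝ → ℝ}
    (hf : Continuous f) (hf0 : ∀ x, 0 ≤ f x) (ψ : H) :
    (inner ℂ (X ψ) (cfc f B (X ψ))).re ≤ ‖X‖ ^ 2 * (inner ℂ ψ (cfc f A ψ)).re := by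
  rw [inner_cfc_eq_norm_sq _ hf hf0, inner_cfc_eq_norm_sq _ hf hf0, ← mul_pow]
  have h := congrArg (fun T => T ψ) (comp_cfc_eq hA hB hX hf.sqrt)
  simp only [ContinuousLinearMap.comp_apply] at h
  rw [← h]
  gcongr
  exact X.le_opNorm _

/-- An Urysohn function between a compact subset and `U` reduces this to the quadratic form bound.
Open sets are enough, since outer regularity then yields absolute continuity. -/
theorem spectralMeasure_intertwine_le {A : H →L[ℂ] H} {B : K →L[ℂ] K} (hA : IsSelfAdjoint A)
    (hB : IsSelfAdjoint B) {X : H →L[ℂ] K} (hX : X ∘L A = B ∘L X) (ψ : H) {U : Set ℝ}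
    (hU : IsOpen U) :
    spectralMeasure B (X ψ) U ≤ ENNReal.ofReal (‖X‖ ^ 2) * spectralMeasure A ψ U := by
  rw [hU.measure_eq_iSup_isCompact]
  refine iSup_le fun C => iSup_le fun hCU => iSup_le fun hC => ?_
  obtain ⟨f, hf1, hfc, hfU, hf01⟩ := exists_continuousMap_one_of_isCompact_subset_isOpen hC hU hCU
  let g : C_c(ℝ, ℝ) := ⟨f, hfc⟩
  calc spectralMeasure B (X ψ) C ≤ ENNReal.ofReal (inner ℂ (X ψ) (cfc f B (X ψ))).re :=
        RealRMK.rieszMeasure_le_of_eq_one (spectralFunctional B (X ψ)) (f := g)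
          (fun x => (hf01 x).1) hC hf1
    _ ≤ ENNReal.ofReal (‖X‖ ^ 2 * (inner ℂ ψ (cfc f A ψ)).re) :=
        ENNReal.ofReal_le_ofReal
          (inner_cfc_intertwine_le hA hB hX f.continuous (fun x => (hf01 x).1) ψ)
    _ = ENNReal.ofReal (‖X‖ ^ 2) * ENNReal.ofReal (inner ℂ ψ (cfc f A ψ)).re :=
        ENNReal.ofReal_mul (sq_nonneg _)
    _ ≤ _ := by
        gcongr
        exact RealRMK.le_rieszMeasure_tsupport_subset (spectralFunctional A ψ) (f := g) hf01 hfU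

theorem spectralMeasure_intertwine_absolutelyContinuous {A : H →L[ℂ] H} {B : K →L[ℂ] K}
    (hA : IsSelfAdjoint A) (hB : IsSelfAdjoint B) {X : H →L[ℂ] K} (hX : X ∘L A = B ∘L X)
    (ψ : H) : spectralMeasure B (X ψ) ≪ spectralMeasure A ψ := by
  intro s hs
  rw [← nonpos_iff_eq_zero]
  have h : ∀ U : Set ℝ, s ⊆ U → IsOpen U →
      spectralMeasure B (X ψ) s ≤ ENNReal.ofReal (‖X‖ ^ 2) * spectralMeasure A ψ U :=
    fun U hsU hU => (measure_mono hsU).trans (spectralMeasure_intertwine_le hA hB hX ψ hU)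
  by_contra! hlt
  set c := ENNReal.ofReal (‖X‖ ^ 2)
  have hc : c ≠ ⊤ := ENNReal.ofReal_ne_top
  -- The divisor is `c + 1` because `c` may be zero.
  have hpos : spectralMeasure A ψ s < spectralMeasure B (X ψ) s / (c + 1) := by
    rw [hs]
    exact ENNReal.div_pos hlt.ne' (ENNReal.add_ne_top.2 ⟨hc, ENNReal.one_ne_top⟩)
  obtain ⟨U, hsU, hU, hUlt⟩ := s.exists_isOpen_lt_of_lt _ hpos
  have hmul : (c + 1) * spectralMeasure A ψ U < spectralMeasure B (X ψ) s := by
    rw [mul_comm]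
    exact (ENNReal.lt_div_iff_mul_lt (Or.inl (by simp))
      (Or.inl (ENNReal.add_ne_top.2 ⟨hc, ENNReal.one_ne_top⟩))).1 hUlt
  refine absurd (h U hsU hU) (not_le.2 (lt_of_le_of_lt ?_ hmul))
  gcongr
  exact le_self_add

theorem intertwine_mem_acSubspace {A : H →L[ℂ] H} {B : K →L[ℂ] K}
    (hA : IsSelfAdjoint A) (hB : IsSelfAdjoint B) {X : H →L[ℂ] K} (hX : X ∘L A = B ∘L X)
    {ψ : H} (hψ : ψ ∈ acSubspace A) : X ψ ∈ acSubspace B :=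
  (spectralMeasure_intertwine_absolutelyContinuous hA hB hX ψ).trans hψ

theorem cfc_comp_self {A : H →L[ℂ] H} (hA : IsSelfAdjoint A) (f : ℝ → ℝ) :
    cfc f A ∘L A = A ∘L cfc f A := by
  have h := (cfc_commute_cfc f id A).eq
  rwa [cfc_id ℝ A] at h

theorem cfc_mem_acSubspace {A : H →L[ℂ] H} (hA : IsSelfAdjoint A) (f : ℝ → ℝ)
    {ψ : H} (hψ : ψ ∈ acSubspace A) : cfc f A ψ ∈ acSubspace A :=
  intertwine_mem_acSubspace hA hA (cfc_comp_self hA f) hψ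

theorem spectralMeasure_univ_le (A : H →L[ℂ] H) (ψ : H) :
    spectralMeasure A ψ Set.univ ≤ ENNReal.ofReal (‖ψ‖ ^ 2) := by
  rw [isOpen_univ.measure_eq_iSup_isCompact]
  refine iSup_le fun C => iSup_le fun hCU => iSup_le fun hC => ?_
  obtain ⟨f, hf1, hfc, hfU, hf01⟩ :=
    exists_continuousMap_one_of_isCompact_subset_isOpen hC isOpen_univ hCU
  let g : C_c(ℝ, ℝ) := ⟨f, hfc⟩
  refine (RealRMK.rieszMeasure_le_of_eq_one (spectralFunctional A ψ) (f := g)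
    (fun x => (hf01 x).1) hC hf1).trans (ENNReal.ofReal_le_ofReal ?_)
  change (inner ℂ ψ (cfc f A ψ)).re ≤ _
  have hn : ‖cfc f A‖ ≤ 1 := norm_cfc_le zero_le_one fun x _ => by
    rw [Real.norm_eq_abs, abs_of_nonneg (hf01 x).1]
    exact (hf01 x).2
  calc _ ≤ ‖ψ‖ * ‖cfc f A ψ‖ := re_inner_le_norm (𝕜 := ℂ) _ _
    _ ≤ ‖ψ‖ * (1 * ‖ψ‖) := by
        gcongr
        exact (cfc f A).le_of_opNorm_le hn ψ
    _ = ‖ψ‖ ^ 2 := by ring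

theorem eq_zero_of_spectralMeasure_eq_zero {A : H →L[ℂ] H} (hA : IsSelfAdjoint A) {ψ : H}
    (h : spectralMeasure A ψ = 0) : ψ = 0 := by
  obtain ⟨f, hf1, hfc, -, -⟩ := exists_continuousMap_one_of_isCompact_subset_isOpen
    (ContinuousFunctionalCalculus.isCompact_spectrum (R := ℝ) A) isOpen_univ (Set.subset_univ _)
  have hi := integral_spectralMeasure A ψ (⟨f, hfc⟩ : C_c(ℝ, ℝ))
  have e : cfc (fun x : ℝ => (⟨f, hfc⟩ : C_c(ℝ, ℝ)) x) A = 1 := by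
    rw [← cfc_one ℝ A]
    exact cfc_congr hf1
  rw [h, integral_zero_measure, e] at hi
  change 0 = (inner ℂ ψ ψ).re at hi
  have hn : (inner ℂ ψ ψ).re = ‖ψ‖ ^ 2 := inner_self_eq_norm_sq (𝕜 := ℂ) ψ
  rw [hn] at hi
  simpa using hi.symm

/-! ### Closedness, moments and eigenvectors -/

/-- The absolutely continuous subspace is closed. -/
theorem isClosed_acSubspace (A : H →L[ℂ] H) :
    IsClosed (acSubspace A : Set H) := by
  refine isClosed_of_closure_subset fun ψ hψ => ?_
  intro s hs
  rw [← nonpos_iff_eq_zero]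
  refine ENNReal.le_of_forall_pos_le_add fun ε hε _ => ?_
  -- The parallelogram bound counts the measure of `ψ - φ` twice, hence the half.
  have hε2 : 0 < √((ε : ℝ) / 2) := Real.sqrt_pos.2 (by positivity)
  obtain ⟨φ, hφ, hd⟩ := Metric.mem_closure_iff.1 hψ _ hε2
  have hle := spectralMeasure_add_le A φ (ψ - φ) s
  rw [add_sub_cancel] at hle
  simp only [Measure.add_apply, hφ hs, zero_add] at hle
  have hn : ‖ψ - φ‖ ^ 2 ≤ (ε : ℝ) / 2 := by
    rw [dist_eq_norm] at hd
    calc _ ≤ √((ε : ℝ) / 2) ^ 2 := by gcongr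
      _ = _ := Real.sq_sqrt (by positivity)
  have h1 : spectralMeasure A (ψ - φ) s ≤ ENNReal.ofReal ((ε : ℝ) / 2) :=
    (measure_mono (Set.subset_univ s)).trans
      ((spectralMeasure_univ_le A _).trans (ENNReal.ofReal_le_ofReal hn))
  refine (hle.trans (add_le_add h1 h1)).trans ?_
  rw [← ENNReal.ofReal_add (by positivity) (by positivity), add_halves, ENNReal.ofReal_coe_nnreal,
    zero_add]

/-- The spectral measure is determined by its moments. -/
theorem spectralMeasure_eq_of_polynomial {A : H →L[ℂ] H} (hA : IsSelfAdjoint A) {s : Set ℝ}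
    (hs : IsCompact s) (hAs : spectrum ℝ A ⊆ s) {ψ : H} {ν : Measure ℝ} [IsFiniteMeasure ν]
    (hν : ∀ᵐ x ∂ν, x ∈ s)
    (h : ∀ p : Polynomial ℝ, (inner ℂ ψ (Polynomial.aeval A p ψ)).re = ∫ x, p.eval x ∂ν) :
    spectralMeasure A ψ = ν := by
  have key : ∀ f : ℝ → ℝ, Continuous f → Integrable f ν →
      (inner ℂ ψ (cfc f A ψ)).re = ∫ x, f x ∂ν := by
    intro f hf hfi
    rw [← sub_eq_zero, ← abs_nonpos_iff]
    refine le_of_forall_pos_le_add fun ε hε => ?_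
    -- The polynomial error is paid once in the quadratic form, with weight `‖ψ‖ ^ 2`, and once in
    -- the integral, with the mass of `ν`.
    set δ := ε / (‖ψ‖ ^ 2 + ν.real Set.univ + 1) with hδ
    have hν0 : 0 ≤ ν.real Set.univ := measureReal_nonneg
    have hδ0 : 0 < δ := by positivity
    obtain ⟨p, hp⟩ := exists_polynomial_near_on_union hs hs hf hδ0
    rw [Set.union_self] at hp
    have h1 := norm_aeval_sub_cfc_le hA hf hδ0.le fun x hx => hp x (hAs hx)
    have h2 : |(inner ℂ ψ (Polynomial.aeval A p ψ)).re - (inner ℂ ψ (cfc f A ψ)).re|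
        ≤ δ * ‖ψ‖ ^ 2 := by
      rw [← Complex.sub_re, ← inner_sub_right]
      refine (Complex.abs_re_le_norm _).trans ((norm_inner_le_norm _ _).trans ?_)
      have h3 := (Polynomial.aeval A p - cfc f A).le_of_opNorm_le h1 ψ
      calc _ ≤ ‖ψ‖ * (δ * ‖ψ‖) := by
            gcongr
            exact h3
        _ = _ := by ring
    have hpi : Integrable (fun x => p.eval x) ν := by
      obtain ⟨C, hC⟩ := hs.exists_bound_of_continuousOn p.continuous.continuousOn
      exact Integrable.of_bound p.continuous.aestronglyMeasurable C (hν.mono hC)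
    have h4 : |∫ x, p.eval x ∂ν - ∫ x, f x ∂ν| ≤ δ * ν.real Set.univ := by
      rw [← integral_sub hpi hfi]
      exact norm_integral_le_of_norm_le_const (f := fun x => p.eval x - f x)
        (hν.mono fun x hx => hp x hx)
    have h5 : δ * ‖ψ‖ ^ 2 + δ * ν.real Set.univ ≤ ε := by
      calc _ ≤ δ * (‖ψ‖ ^ 2 + ν.real Set.univ + 1) := by nlinarith
        _ = ε := by rw [hδ]; field_simp
    rw [h] at h2
    rw [abs_le] at *
    constructor <;> linarith [h2.1, h2.2, h4.1, h4.2]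
  apply Measure.ext_of_integral_eq_on_compactlySupported
  intro f
  rw [integral_spectralMeasure]
  exact key f f.continuous f.integrable

theorem cfc_apply_of_eigenvector {A : H →L[ℂ] H} (hA : IsSelfAdjoint A) {ψ : H} {z : ℝ}
    (h : A ψ = (z : ℂ) • ψ) {f : ℝ → ℝ} (hf : Continuous f) : cfc f A ψ = (f z : ℂ) • ψ := by
  -- An eigenvector is an intertwiner: `c ↦ c ψ` carries multiplication by `z` on `ℂ` to `A`.
  have hX : (ContinuousLinearMap.toSpanSingleton ℂ ψ) ∘L (algebraMap ℝ (ℂ →L[ℂ] ℂ) z)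
      = A ∘L (ContinuousLinearMap.toSpanSingleton ℂ ψ) := by
    ext
    simp [h, Algebra.algebraMap_eq_smul_one]
  have hz : IsSelfAdjoint (algebraMap ℝ (ℂ →L[ℂ] ℂ) z) := IsSelfAdjoint.algebraMap _ (.all z)
  have := congrArg (fun T => T 1) (comp_cfc_eq hz hA hX hf)
  rw [cfc_algebraMap] at this
  simpa [Algebra.algebraMap_eq_smul_one] using this.symm

theorem spectralMeasure_of_eigenvector {A : H →L[ℂ] H} (hA : IsSelfAdjoint A) {ψ : H} {z : ℝ}
    (h : A ψ = (z : ℂ) • ψ) : spectralMeasure A ψ = (‖ψ‖₊ ^ 2) • Measure.dirac z := by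
  apply Measure.ext_of_integral_eq_on_compactlySupported
  intro f
  have hf : cfc (fun x : ℝ => f x) A ψ = (f z : ℂ) • ψ :=
    cfc_apply_of_eigenvector hA h f.continuous
  rw [integral_smul_nnreal_measure, integral_spectralMeasure, integral_dirac, hf, inner_smul_right,
    NNReal.smul_def, Complex.re_ofReal_mul]
  have hn : (inner ℂ ψ ψ).re = ‖ψ‖ ^ 2 := inner_self_eq_norm_sq (𝕜 := ℂ) ψ
  rw [hn, mul_comm]
  simp

theorem eq_zero_of_eigenvector {A : H →L[ℂ] H} (hA : IsSelfAdjoint A) {ψ : H} {z : ℝ}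
    (h : A ψ = (z : ℂ) • ψ) (h0 : spectralMeasure A ψ {z} = 0) : ψ = 0 := by
  rw [spectralMeasure_of_eigenvector hA h] at h0
  simpa using h0

theorem eq_zero_of_eigenvector_of_mem_acSubspace {A : H →L[ℂ] H} (hA : IsSelfAdjoint A) {ψ : H}
    {z : ℝ} (h : A ψ = (z : ℂ) • ψ) (hψ : ψ ∈ acSubspace A) : ψ = 0 :=
  eq_zero_of_eigenvector hA h (hψ Real.volume_singleton)

/-! ### Spectral consequences of the range of `A² - e²` -/

/-- Factor `A² - e² = (A + e)(A - e)`: first `(A - e) ψ` is killed by `A + e` and so vanishes, then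
`ψ` is killed by `A - e`. -/
theorem eq_zero_of_apply_apply_eq {H : Type*} [NormedAddCommGroup H] [NormedSpace ℂ H]
    {A : H →L[ℂ] H} {p : Submodule ℂ H}
    (hp : ∀ ψ ∈ p, A ψ ∈ p) (hp0 : ∀ ψ ∈ p, ∀ z : ℝ, A ψ = (z : ℂ) • ψ → ψ = 0) {e : ℝ}
    {ψ : H} (hψ : ψ ∈ p) (h : A (A ψ) = ((e : ℂ) ^ 2) • ψ) : ψ = 0 := by
  have h1 : A ψ - (e : ℂ) • ψ = 0 := by
    refine hp0 _ (p.sub_mem (hp _ hψ) (p.smul_mem _ hψ)) (-e) ?_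
    rw [map_sub, h, map_smul, smul_sub, smul_smul]
    push_cast
    rw [neg_smul, neg_mul, neg_smul, ← sq]
    abel
  exact hp0 ψ hψ e (sub_eq_zero.1 h1)

theorem cfc_eq_zero_of_eqOn {B : K →L[ℂ] K} {s : Set ℝ} (hBs : spectrum ℝ B ⊆ s) {k : ℝ → ℝ}
    (hk : ∀ x ∈ s, k x = 0) : cfc k B = 0 := by
  rw [cfc_congr (g := fun _ => 0) fun x hx => hk x (hBs hx)]
  exact cfc_const_zero ℝ B

/-- The vectors in the range of an operator intertwining `B` with `A` are annihilated by the
functions of `A` that vanish on the spectrum of `B`. -/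
theorem cfc_apply_intertwine_eq_zero {A : H →L[ℂ] H} {B : K →L[ℂ] K} (hA : IsSelfAdjoint A)
    (hB : IsSelfAdjoint B) {s : Set ℝ} (hBs : spectrum ℝ B ⊆ s) {X : K →L[ℂ] H}
    (hX : X ∘L B = A ∘L X) {k : ℝ → ℝ} (hkc : Continuous k) (hk : ∀ x ∈ s, k x = 0) (ψ : K) :
    cfc k A (X ψ) = 0 := by
  have h := congrArg (fun T => T ψ) (comp_cfc_eq hB hA hX hkc)
  simp only [ContinuousLinearMap.comp_apply] at h
  rw [← h, cfc_eq_zero_of_eqOn hBs hk]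
  simp

/-- If `A² - e²` maps into the absolutely continuous subspace, then there is no singular
continuous spectrum. -/
theorem specSC_eq_empty {A : H →L[ℂ] H} (hA : IsSelfAdjoint A) {e : ℝ}
    (hac : ∀ ψ, A (A ψ) - ((e : ℂ) ^ 2) • ψ ∈ acSubspace A) : specSC A hA = ∅ := by
  have h0 : ∀ ψ ∈ scSubspace A, ψ = 0 := by
    intro ψ hψ
    refine eq_zero_of_apply_apply_eq (apply_mem_scSubspace A hA)
      (fun φ hφ z hz => eq_zero_of_eigenvector hA hz (hφ.1 z)) hψ (e := e) ?_
    have hsc : A (A ψ) - ((e : ℂ) ^ 2) • ψ ∈ scSubspace A :=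
      (scSubspace A).sub_mem (apply_mem_scSubspace A hA _ (apply_mem_scSubspace A hA _ hψ))
        ((scSubspace A).smul_mem _ hψ)
    exact sub_eq_zero.1 (eq_zero_of_spectralMeasure_eq_zero hA
      (Measure.eq_zero_of_absolutelyContinuous_of_mutuallySingular (hac ψ) hsc.2))
  have : Subsingleton (scSubspace A) :=
    ⟨fun x y => Subtype.ext ((h0 x x.2).trans (h0 y y.2).symm)⟩
  have : Subsingleton (scSubspace A →L[ℂ] scSubspace A) :=
    ⟨fun f g => ContinuousLinearMap.ext fun x => Subsingleton.elim _ _⟩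
  exact spectrum.of_subsingleton _

/-- The vector `k(A) φ` remains absolutely continuous and solves `A² η = e² η`, which forces it to
vanish. -/
theorem cfc_apply_eq_zero_of_mem_acSubspace {A : H →L[ℂ] H} (hA : IsSelfAdjoint A) {e : ℝ}
    {k : ℝ → ℝ} (hk : ∀ ψ, cfc k A (A (A ψ) - ((e : ℂ) ^ 2) • ψ) = 0)
    {φ : H} (hφ : φ ∈ acSubspace A) : cfc k A φ = 0 := by
  refine eq_zero_of_apply_apply_eq (apply_mem_acSubspace A hA)
    (fun _ hη z hz => eq_zero_of_eigenvector_of_mem_acSubspace hA hz hη)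
    (cfc_mem_acSubspace hA k hφ) (e := e) ?_
  have h := hk φ
  have hc : ∀ v, cfc k A (A v) = A (cfc k A v) := fun v =>
    congrArg (fun T => T v) (cfc_comp_self hA k)
  rw [map_sub, map_smul, hc, hc] at h
  exact sub_eq_zero.1 h

/-- The functional calculus takes real functions only, so the resolvent at a complex `z` is built
from `g = 1 / |x - z|²` as `(z̄ - A) g(A)`. Truncating the denominator from below by its minimum on
`s` makes `g` continuous on the whole line. -/
theorem exists_continuous_mul_normSq_sub_eq_one {s : Set ℝ} (hs : IsCompact s) {z : ℂ}
    (hz : ∀ x ∈ s, (x : ℂ) ≠ z) :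
    ∃ g : ℝ → ℝ, Continuous g ∧ ∀ x ∈ s, g x * Complex.normSq (x - z) = 1 := by
  have hc : Continuous fun x : ℝ => Complex.normSq ((x : ℂ) - z) := by fun_prop
  have hp : ∀ x ∈ s, 0 < Complex.normSq ((x : ℂ) - z) := fun x hx =>
    Complex.normSq_pos.2 (sub_ne_zero.2 (hz x hx))
  obtain ⟨δ, hδ, hδs⟩ : ∃ δ : ℝ, 0 < δ ∧ ∀ x ∈ s, δ ≤ Complex.normSq ((x : ℂ) - z) := by
    rcases s.eq_empty_or_nonempty with rfl | hne
    · exact ⟨1, one_pos, by simp⟩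
    · obtain ⟨x, hx, hmin⟩ := hs.exists_isMinOn hne hc.continuousOn
      exact ⟨_, hp x hx, fun y hy => hmin hy⟩
  have hpos : ∀ x : ℝ, max δ (Complex.normSq ((x : ℂ) - z)) ≠ 0 := fun x =>
    (lt_max_of_lt_left hδ).ne'
  refine ⟨fun x => (max δ (Complex.normSq ((x : ℂ) - z)))⁻¹, (continuous_const.max hc).inv₀ hpos,
    fun x hx => ?_⟩
  change (max δ (Complex.normSq ((x : ℂ) - z)))⁻¹ * _ = 1
  rw [max_eq_right (hδs x hx)]
  exact inv_mul_cancel₀ (hp x hx).ne'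

theorem cfc_mul_normSq_sub {A : H →L[ℂ] H} (hA : IsSelfAdjoint A) {g : ℝ → ℝ} (hg : Continuous g)
    (z : ℂ) (ψ : H) :
    cfc (fun x : ℝ => g x * Complex.normSq (x - z) - 1) A ψ
      = (A (A (cfc g A ψ)) - (2 * z.re : ℂ) • A (cfc g A ψ) + (Complex.normSq z : ℂ) • cfc g A ψ)
        - ψ := by
  have e : (fun x : ℝ => g x * Complex.normSq (x - z) - 1)
      = fun x : ℝ => (x * (x * g x) - (2 * z.re) • (x * g x) + (Complex.normSq z) • g x) - 1 := by
    funext x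
    simp only [Complex.normSq_apply, Complex.sub_re, Complex.sub_im, Complex.ofReal_re,
      Complex.ofReal_im, smul_eq_mul]
    ring
  have h1 : cfc (fun x : ℝ => x * g x) A = A * cfc g A := by
    rw [cfc_mul (fun x : ℝ => x) g A continuousOn_id hg.continuousOn, cfc_id' ℝ A]
  have h2 : cfc (fun x : ℝ => x * (x * g x)) A = A * (A * cfc g A) := by
    rw [cfc_mul (fun x : ℝ => x) (fun x => x * g x) A continuousOn_id (by fun_prop), h1,
      cfc_id' ℝ A]
  rw [e, cfc_sub _ _ A (by fun_prop) (by fun_prop), cfc_add (a := A) _ _ (by fun_prop) (by fun_prop),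
    cfc_sub _ _ A (by fun_prop) (by fun_prop), cfc_smul _ _ A (by fun_prop),
    cfc_smul _ _ A (by fun_prop), h1, h2, cfc_const_one ℝ A]
  change (A (A (cfc g A ψ)) - (2 * z.re : ℝ) • A (cfc g A ψ)
    + (Complex.normSq z : ℝ) • cfc g A ψ) - ψ = _
  rw [← Complex.coe_smul, ← Complex.coe_smul]
  push_cast
  rfl

/-- If the functions of `A` that vanish on the compact set `s` annihilate the absolutely
continuous subspace, then the absolutely continuous spectrum is contained in `s`. -/
theorem specAC_subset {A : H →L[ℂ] H} (hA : IsSelfAdjoint A) {s : Set ℝ} (hs : IsCompact s)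
    (h : ∀ k : ℝ → ℝ, Continuous k → (∀ x ∈ s, k x = 0) → ∀ φ ∈ acSubspace A, cfc k A φ = 0) :
    specAC A hA ⊆ (fun t : ℝ => (t : ℂ)) '' s := by
  intro z hz
  by_contra hzs
  obtain ⟨g, hg, hgz⟩ := exists_continuous_mul_normSq_sub_eq_one hs (z := z)
    fun x hx hxz => hzs ⟨x, hx, hxz⟩
  refine hz ?_
  let G : acSubspace A →L[ℂ] acSubspace A :=
    (cfc g A).restrict fun ψ hψ => cfc_mem_acSubspace hA g hψ
  let R := A.restrict (apply_mem_acSubspace A hA)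
  have hGR : G * R = R * G := by
    ext φ
    exact congrArg (fun T => T (φ : H)) (cfc_comp_self hA g)
  -- `g(x)|x - z|² - 1` vanishes on `s`, so by hypothesis its functional calculus is zero on the
  -- absolutely continuous subspace.
  have key : R * (R * G) - (2 * z.re : ℂ) • (R * G) + (Complex.normSq z : ℂ) • G = 1 := by
    ext φ
    have h1 := h (fun x : ℝ => g x * Complex.normSq (x - z) - 1) (by fun_prop)
      (fun x hx => sub_eq_zero.2 (hgz x hx)) φ φ.2
    rw [cfc_mul_normSq_sub hA hg] at h1
    exact sub_eq_zero.1 h1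
  have hfac : (algebraMap ℂ _ z - R) * ((algebraMap ℂ _ ((starRingEnd ℂ) z) - R) * G) = 1 := by
    rw [← key]
    have e1 : (2 * z.re : ℂ) = z + (starRingEnd ℂ) z := by
      rw [Complex.add_conj]
      push_cast
      rfl
    rw [e1, Complex.normSq_eq_conj_mul_self]
    simp only [Algebra.algebraMap_eq_smul_one, sub_mul, mul_sub, smul_mul_assoc, one_mul,
      mul_smul_comm]
    module
  have hcomm : (algebraMap ℂ _ ((starRingEnd ℂ) z) - R) * G * (algebraMap ℂ _ z - R)
      = (algebraMap ℂ _ z - R) * ((algebraMap ℂ _ ((starRingEnd ℂ) z) - R) * G) := by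
    have hc : Commute R G := hGR.symm
    have c1 : Commute (algebraMap ℂ (acSubspace A →L[ℂ] acSubspace A) z - R) G :=
      (Algebra.commute_algebraMap_left z G).sub_left hc
    have c2 : Commute (algebraMap ℂ (acSubspace A →L[ℂ] acSubspace A) z - R)
        (algebraMap ℂ _ ((starRingEnd ℂ) z) - R) :=
      ((Algebra.commute_algebraMap_left z _).sub_right (Algebra.commute_algebraMap_left z R)).sub_left
        ((Algebra.commute_algebraMap_right ((starRingEnd ℂ) z) R).sub_right (Commute.refl R))
    exact ((c2.mul_right c1).eq).symm
  exact ⟨⟨_, _, hfac, hcomm.trans hfac⟩, rfl⟩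

/-- If `A² - e²` maps into the span of the ranges of operators intertwining `A` with a purely
absolutely continuous operator `B`, then it maps into the absolutely continuous subspace. -/
theorem apply_apply_sub_mem_acSubspace {A : H →L[ℂ] H} {B : K →L[ℂ] K} (hA : IsSelfAdjoint A)
    (hB : IsSelfAdjoint B) (hBac : ∀ φ, φ ∈ acSubspace B) {e : ℝ}
    (h : ∀ N : Submodule ℂ H, (∀ X : K →L[ℂ] H, X ∘L B = A ∘L X → ∀ φ, X φ ∈ N) →
      ∀ ψ, A (A ψ) - ((e : ℂ) ^ 2) • ψ ∈ N) (ψ : H) :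
    A (A ψ) - ((e : ℂ) ^ 2) • ψ ∈ acSubspace A :=
  h _ (fun _ hX φ => intertwine_mem_acSubspace hB hA hX (hBac φ)) ψ

theorem specAC_subset_of_intertwine {A : H →L[ℂ] H} {B : K →L[ℂ] K} (hA : IsSelfAdjoint A)
    (hB : IsSelfAdjoint B) {s : Set ℝ} (hs : IsCompact s) (hBs : spectrum ℝ B ⊆ s) {e : ℝ}
    (h : ∀ N : Submodule ℂ H, (∀ X : K →L[ℂ] H, X ∘L B = A ∘L X → ∀ φ, X φ ∈ N) →
      ∀ ψ, A (A ψ) - ((e : ℂ) ^ 2) • ψ ∈ N) :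
    specAC A hA ⊆ (fun t : ℝ => (t : ℂ)) '' s := by
  refine specAC_subset hA hs fun k hkc hk φ hφ =>
    cfc_apply_eq_zero_of_mem_acSubspace hA (e := e) (fun ψ => ?_) hφ
  exact h (LinearMap.ker (cfc k A).toLinearMap)
    (fun _ hX φ => LinearMap.mem_ker.2 (cfc_apply_intertwine_eq_zero hA hB hBs hX hkc hk φ)) ψ

/-- A point is in the absolutely continuous spectrum if some vector of the absolutely continuous
subspace is not in the range of `A - z`. -/
theorem mem_specAC_of_forall_ne {A : H →L[ℂ] H} (hA : IsSelfAdjoint A) {z : ℂ} {ψ : H}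
    (hψ : ψ ∈ acSubspace A) (h : ∀ φ, z • φ - A φ ≠ ψ) : z ∈ specAC A hA := by
  intro hu
  obtain ⟨u, hu⟩ := hu
  refine h ((↑u⁻¹ : acSubspace A →L[ℂ] acSubspace A) ⟨ψ, hψ⟩) ?_
  have h1 := congrArg (fun T => ((T ⟨ψ, hψ⟩ : acSubspace A) : H)) u.mul_inv
  rw [hu] at h1
  exact h1

theorem eigenvalue_real {A : H →L[ℂ] H} (hA : IsSelfAdjoint A) {z : ℂ} {ψ : H} (hψ : ψ ≠ 0)
    (h : A ψ = z • ψ) : ((z.re : ℝ) : ℂ) = z := by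
  have hev : Module.End.HasEigenvalue (A : H →ₗ[ℂ] H) z :=
    Module.End.hasEigenvalue_of_hasEigenvector
      (x := ψ) ⟨Module.End.mem_eigenspace_iff.2 h, hψ⟩
  exact Complex.conj_eq_iff_re.1 (hA.isSymmetric.conj_eigenvalue_eq_self hev)

/-- On an eigenvector `A² - e²` is the scalar `z² - e²`. If it were nonzero, the eigenvector itself
would be absolutely continuous, but its spectral measure is an atom. -/
theorem eigenvalue_sq_eq {A : H →L[ℂ] H} (hA : IsSelfAdjoint A) {e : ℝ}
    (hac : ∀ ψ, A (A ψ) - ((e : ℂ) ^ 2) • ψ ∈ acSubspace A) {z : ℂ} {ψ : H} (hψ : ψ ≠ 0)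
    (h : A ψ = z • ψ) : z ^ 2 = (e : ℂ) ^ 2 := by
  by_contra hne
  refine hψ (eq_zero_of_eigenvector_of_mem_acSubspace hA (z := z.re)
    (by rw [eigenvalue_real hA hψ h, h]) ?_)
  have h1 := hac ψ
  rw [h, map_smul, h, smul_smul, ← sub_smul, ← sq] at h1
  exact ((acSubspace A).smul_mem_iff (sub_ne_zero.2 hne)).1 h1

end SpectralTypes

open SpectralTypes

noncomputable section

namespace MagneticXY

/-! ### The free Hamiltonian and its absolute continuity -/

theorem inner_delta_left (x : ℤ) (f : OneParticle) : inner ℂ (delta x) f = (f : ℤ → ℂ) x := by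
  rw [delta, lp.inner_single_left]
  simp

theorem delta_apply (x y : ℤ) : (delta x : ℤ → ℂ) y = if y = x then 1 else 0 := by
  rw [delta, lp.coeFn_single, Pi.single_apply]

theorem shift_delta (x : ℤ) : shift (delta x) = delta (x + 1) := by
  ext y
  simp only [shift_apply, delta_apply, sub_eq_iff_eq_add]

@[simp] theorem adjoint_shift_apply (f : OneParticle) (x : ℤ) :
    (ContinuousLinearMap.adjoint shift f : ℤ → ℂ) x = (f : ℤ → ℂ) (x + 1) := by
  rw [← inner_delta_left, ContinuousLinearMap.adjoint_inner_right, shift_delta, inner_delta_left]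

theorem adjoint_shift_delta (x : ℤ) :
    ContinuousLinearMap.adjoint shift (delta x) = delta (x - 1) := by
  ext y
  simp only [adjoint_shift_apply, delta_apply, eq_sub_iff_add_eq]

@[simp] theorem hXY_apply (f : OneParticle) (x : ℤ) :
    (hXY f : ℤ → ℂ) x = 1 / 2 * ((f : ℤ → ℂ) (x - 1) + (f : ℤ → ℂ) (x + 1)) := by
  change (1 / 2 : ℂ) * ((shift f : ℤ → ℂ) x + (ContinuousLinearMap.adjoint shift f : ℤ → ℂ) x) = _
  simp

@[simp] theorem hB_apply (κ : ℝ) (f : OneParticle) (x : ℤ) :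
    (hB κ f : ℤ → ℂ) x = 1 / 2 * ((f : ℤ → ℂ) (x - 1) + (f : ℤ → ℂ) (x + 1))
      + if x = 0 then (κ : ℂ) * (f : ℤ → ℂ) 0 else 0 := by
  change (hXY f : ℤ → ℂ) x + (κ : ℂ) * (inner ℂ (delta 0) f * (delta 0 : ℤ → ℂ) x) = _
  rw [hXY_apply, inner_delta_left, delta_apply]
  simp

theorem isSelfAdjoint_hXY : IsSelfAdjoint hXY := by
  have h := isSelfAdjoint_hB 0
  simpa [hB] using h

theorem norm_hXY_le : ‖hXY‖ ≤ 1 := by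
  have h1 : ‖shift‖ ≤ 1 := LinearMap.mkContinuous_norm_le _ zero_le_one _
  have h2 : ‖ContinuousLinearMap.adjoint shift‖ ≤ 1 := by
    rwa [LinearIsometryEquiv.norm_map]
  calc ‖hXY‖ = 1 / 2 * ‖shift + ContinuousLinearMap.adjoint shift‖ := by
        rw [hXY, reOp, norm_smul]
        norm_num
    _ ≤ 1 / 2 * (1 + 1) := by
        gcongr
        exact (norm_add_le _ _).trans (add_le_add h1 h2)
    _ = 1 := by norm_num

instance : Nontrivial OneParticle :=
  ⟨0, delta 0, fun h => by simpa [delta] using congrArg norm h⟩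

theorem spectrum_hXY_subset : spectrum ℝ hXY ⊆ Set.Icc (-1) 1 := fun _ hx =>
  abs_le.1 ((spectrum.norm_le_norm_of_mem hx).trans norm_hXY_le)

theorem integral_cos_int_mul (n : ℤ) :
    ∫ θ in (0 : ℝ)..Real.pi, Real.cos (n * θ) = if n = 0 then Real.pi else 0 := by
  split_ifs with h
  · simp [h]
  · have hn : (n : ℝ) ≠ 0 := by exact_mod_cast h
    rw [intervalIntegral.integral_comp_mul_left Real.cos hn, integral_cos]
    simp [Real.sin_int_mul_pi]

/-- The Fourier transform makes `h` multiplication by `cos θ`; the formula is proved by induction on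
`p`, with no transform needed. -/
theorem aeval_hXY_delta_zero (p : Polynomial ℝ) (n : ℤ) :
    (Polynomial.aeval hXY p (delta 0) : ℤ → ℂ) n
      = ((Real.pi⁻¹ * ∫ θ in (0 : ℝ)..Real.pi, p.eval (Real.cos θ) * Real.cos (n * θ) : ℝ) : ℂ) := by
  have hii : ∀ (q : Polynomial ℝ) (m : ℤ), IntervalIntegrable
      (fun θ : ℝ => q.eval (Real.cos θ) * Real.cos (m * θ)) volume 0 Real.pi := fun q m =>
    Continuous.intervalIntegrable (by fun_prop) _ _
  induction p using Polynomial.induction_on generalizing n with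
  | C a =>
    simp only [Polynomial.aeval_C, Polynomial.eval_C, intervalIntegral.integral_const_mul,
      integral_cos_int_mul, Algebra.algebraMap_eq_smul_one]
    change a • (delta 0 : ℤ → ℂ) n = _
    rw [delta_apply]
    have := Real.pi_ne_zero
    split_ifs
    · simp [mul_comm a]
    · simp
  | add p q hp hq =>
    simp only [map_add, Polynomial.eval_add, add_mul]
    rw [intervalIntegral.integral_add (hii p n) (hii q n), mul_add, Complex.ofReal_add, ← hp, ← hq]
    rfl
  | monomial k a h =>
    have e : (Polynomial.C a * Polynomial.X ^ (k + 1) : Polynomial ℝ)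
        = Polynomial.X * (Polynomial.C a * Polynomial.X ^ k) := by ring
    set q : Polynomial ℝ := Polynomial.C a * Polynomial.X ^ k
    rw [e, map_mul, Polynomial.aeval_X]
    change (hXY (Polynomial.aeval hXY q (delta 0)) : ℤ → ℂ) n = _
    rw [hXY_apply, h, h, ← Complex.ofReal_add, ← mul_add,
      ← intervalIntegral.integral_add (hii q _) (hii q _)]
    -- The product formula for `2 cos θ cos nθ` is the averaging over neighbours performed by `h`.
    have e2 : ∀ θ : ℝ, (Polynomial.X * q).eval (Real.cos θ) * Real.cos (n * θ)
        = 1 / 2 * (q.eval (Real.cos θ) * Real.cos ((n - 1 : ℤ) * θ)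
          + q.eval (Real.cos θ) * Real.cos ((n + 1 : ℤ) * θ)) := by
      intro θ
      push_cast
      rw [sub_mul, add_mul, one_mul, Real.cos_sub, Real.cos_add, Polynomial.eval_mul,
        Polynomial.eval_X]
      ring
    simp only [e2, intervalIntegral.integral_const_mul]
    push_cast
    ring

/-- On `(0, π)` the preimage is an image under `arccos`, which is differentiable on `(-1, 1)` and so
preserves null sets. -/
theorem volume_preimage_cos_eq_zero {s : Set ℝ} (hs : volume s = 0) :
    volume (Real.cos ⁻¹' s ∩ Set.Ioo 0 Real.pi) = 0 := by
  refine measure_mono_null (t := Real.arccos '' (s ∩ Set.Ioo (-1) 1)) ?_ ?_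
  · rintro θ ⟨hθs, hθ⟩
    have hsin := Real.sin_pos_of_pos_of_lt_pi hθ.1 hθ.2
    have hsq := Real.sin_sq_add_cos_sq θ
    refine ⟨Real.cos θ, ⟨hθs, ?_, ?_⟩, Real.arccos_cos hθ.1.le hθ.2.le⟩ <;> nlinarith
  · refine addHaar_image_eq_zero_of_differentiableOn_of_addHaar_eq_zero volume ?_
      (measure_mono_null Set.inter_subset_left hs)
    intro x hx
    exact (Real.differentiableAt_arccos.2 ⟨hx.2.1.ne', hx.2.2.ne⟩).differentiableWithinAt

/-- The arcsine law, written as the image of normalized Lebesgue measure on `(0, π)` under the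
cosine and identified by its moments. -/
theorem spectralMeasure_hXY_delta_zero : spectralMeasure hXY (delta 0)
    = ENNReal.ofReal Real.pi⁻¹ • (volume.restrict (Set.Ioo 0 Real.pi)).map Real.cos := by
  have : IsFiniteMeasure
      (ENNReal.ofReal Real.pi⁻¹ • (volume.restrict (Set.Ioo 0 Real.pi)).map Real.cos) :=
    Measure.smul_finite _ ENNReal.ofReal_ne_top
  refine spectralMeasure_eq_of_polynomial isSelfAdjoint_hXY isCompact_Icc spectrum_hXY_subset ?_ ?_
  · refine Measure.ae_smul_measure ?_ _
    exact (ae_map_iff Real.continuous_cos.aemeasurable measurableSet_Icc).2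
      (Filter.Eventually.of_forall Real.cos_mem_Icc)
  · intro p
    refine (congrArg Complex.re ((inner_delta_left 0 _).trans (aeval_hXY_delta_zero p 0))).trans ?_
    rw [Complex.ofReal_re, integral_smul_measure,
      integral_map Real.continuous_cos.aemeasurable p.continuous.aestronglyMeasurable,
      ENNReal.toReal_ofReal (inv_nonneg.2 Real.pi_pos.le),
      intervalIntegral.integral_of_le Real.pi_pos.le, integral_Ioc_eq_integral_Ioo, smul_eq_mul]
    simp

theorem delta_zero_mem_acSubspace_hXY : delta 0 ∈ acSubspace hXY := by
  change spectralMeasure hXY (delta 0) ≪ volume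
  rw [spectralMeasure_hXY_delta_zero]
  refine Measure.AbsolutelyContinuous.smul_left (Measure.AbsolutelyContinuous.mk fun s hs h0 => ?_) _
  rw [Measure.map_apply Real.measurable_cos hs,
    Measure.restrict_apply (Real.measurable_cos hs)]
  exact volume_preimage_cos_eq_zero h0

/-- Translations commute with `h`, so they are intertwiners that move `δ₀` to every site. -/
theorem delta_mem_acSubspace_hXY (x : ℤ) : delta x ∈ acSubspace hXY := by
  have h1 : shift ∘L hXY = hXY ∘L shift := by
    ext f y
    simp only [ContinuousLinearMap.comp_apply, shift_apply, hXY_apply]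
    ring_nf
  have h2 : ContinuousLinearMap.adjoint shift ∘L hXY
      = hXY ∘L ContinuousLinearMap.adjoint shift := by
    ext f y
    simp only [ContinuousLinearMap.comp_apply, adjoint_shift_apply, hXY_apply]
    ring_nf
  induction x using Int.induction_on with
  | zero => exact delta_zero_mem_acSubspace_hXY
  | succ n ih =>
    rw [← shift_delta]
    exact intertwine_mem_acSubspace isSelfAdjoint_hXY isSelfAdjoint_hXY h1 ih
  | pred n ih =>
    rw [← adjoint_shift_delta]
    exact intertwine_mem_acSubspace isSelfAdjoint_hXY isSelfAdjoint_hXY h2 ih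

/-- The spectrum of the free Hamiltonian is purely absolutely continuous. -/
theorem mem_acSubspace_hXY (f : OneParticle) : f ∈ acSubspace hXY := by
  have hs : HasSum (fun x : ℤ => lp.single 2 x ((f : ℤ → ℂ) x)) f :=
    lp.hasSum_single (by norm_num) f
  refine (isClosed_acSubspace hXY).mem_of_tendsto hs (Filter.Eventually.of_forall fun s => ?_)
  refine (acSubspace hXY).sum_mem fun x _ => ?_
  have e : lp.single 2 x ((f : ℤ → ℂ) x) = (f : ℤ → ℂ) x • delta x := by
    rw [delta, ← lp.single_smul]
    simp
  rw [e]
  exact (acSubspace hXY).smul_mem _ (delta_mem_acSubspace_hXY x)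

/-! ### Gauge, parity and Darboux operators -/

theorem memlp_diag {c : ℤ → ℂ} (hc : ∀ x, ‖c x‖ ≤ 1) (f : OneParticle) :
    Memℓp (fun x : ℤ => c x * (f : ℤ → ℂ) x) 2 :=
  (lp.memℓp f).mono' fun x => by
    rw [norm_mul]
    exact mul_le_of_le_one_left (norm_nonneg _) (hc x)

/-- The multiplication by a function bounded by one on `ℓ²(ℤ)`. -/
def diag (c : ℤ → ℂ) (hc : ∀ x, ‖c x‖ ≤ 1) : OneParticle →L[ℂ] OneParticle :=
  LinearMap.mkContinuous
    { toFun := fun f => ⟨fun x : ℤ => c x * (f : ℤ → ℂ) x, memlp_diag hc f⟩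
      map_add' := fun f g => by
        ext x
        exact mul_add _ _ _
      map_smul' := fun a f => by
        ext x
        exact mul_left_comm _ _ _ } 1
    (fun f => by
      rw [one_mul]
      refine lp.norm_mono (p := 2) (by norm_num) fun x => ?_
      change ‖c x * (f : ℤ → ℂ) x‖ ≤ _
      rw [norm_mul]
      exact mul_le_of_le_one_left (norm_nonneg _) (hc x))

@[simp] theorem diag_apply (c : ℤ → ℂ) (hc : ∀ x, ‖c x‖ ≤ 1) (f : OneParticle) (x : ℤ) :
    (diag c hc f : ℤ → ℂ) x = c x * (f : ℤ → ℂ) x := rfl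

theorem memlp_reflect (f : OneParticle) : Memℓp (fun x : ℤ => (f : ℤ → ℂ) (-x)) 2 := by
  have hf := (memℓp_gen_iff (p := 2) (by norm_num)).1 (lp.memℓp f)
  exact memℓp_gen ((Equiv.neg ℤ).summable_iff.2 hf)

/-- The reflection `(r f)(x) = f(-x)` on `ℓ²(ℤ)`. -/
def reflect : OneParticle →L[ℂ] OneParticle :=
  LinearMap.mkContinuous
    { toFun := fun f => ⟨fun x : ℤ => (f : ℤ → ℂ) (-x), memlp_reflect f⟩
      map_add' := fun f g => rfl
      map_smul' := fun c f => rfl } 1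
    (fun f => by
      rw [one_mul]
      refine lp.norm_le_of_tsum_le (p := 2) (by norm_num) (norm_nonneg f) (le_of_eq ?_)
      rw [lp.norm_rpow_eq_tsum (by norm_num) f]
      exact (Equiv.neg ℤ).tsum_eq
        (fun x : ℤ => ‖(f : ℤ → ℂ) x‖ ^ (2 : ENNReal).toReal))

@[simp] theorem reflect_apply (f : OneParticle) (x : ℤ) :
    (reflect f : ℤ → ℂ) x = (f : ℤ → ℂ) (-x) := rfl

/-- The sign of an integer as a complex number. -/
def csign (x : ℤ) : ℂ := if 0 < x then 1 else if x < 0 then -1 else 0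

theorem norm_csign_le (x : ℤ) : ‖csign x‖ ≤ 1 := by
  unfold csign
  split_ifs <;> simp

theorem norm_neg_one_zpow_le (x : ℤ) : ‖(-1 : ℂ) ^ x‖ ≤ 1 := by simp

/-- The gauge transformation `f(x) ↦ (-1)ˣ f(x)`. -/
def alternate : OneParticle →L[ℂ] OneParticle := diag (fun x => (-1) ^ x) norm_neg_one_zpow_le

theorem alternate_comp_hXY : alternate ∘L hXY = (-hXY) ∘L alternate := by
  ext f x
  change (-1 : ℂ) ^ x * (hXY f : ℤ → ℂ) x = -(hXY (alternate f) : ℤ → ℂ) x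
  rw [hXY_apply, hXY_apply]
  simp only [alternate, diag_apply]
  rw [zpow_sub_one₀ (by norm_num), zpow_add_one₀ (by norm_num)]
  norm_num
  ring

theorem alternate_alternate (f : OneParticle) : alternate (alternate f) = f := by
  ext x
  change (-1 : ℂ) ^ x * ((-1 : ℂ) ^ x * (f : ℤ → ℂ) x) = _
  rw [← mul_assoc, ← mul_zpow]
  simp

/-- The projection onto the odd sequences. -/
def oddProj : OneParticle →L[ℂ] OneParticle :=
  (1 / 2 : ℂ) • (ContinuousLinearMap.id ℂ OneParticle - reflect)

@[simp] theorem oddProj_apply (f : OneParticle) (x : ℤ) :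
    (oddProj f : ℤ → ℂ) x = 1 / 2 * ((f : ℤ → ℂ) x - (f : ℤ → ℂ) (-x)) := rfl

/-- The projection onto the even sequences. -/
def evenProj : OneParticle →L[ℂ] OneParticle :=
  (1 / 2 : ℂ) • (ContinuousLinearMap.id ℂ OneParticle + reflect)

@[simp] theorem evenProj_apply (f : OneParticle) (x : ℤ) :
    (evenProj f : ℤ → ℂ) x = 1 / 2 * ((f : ℤ → ℂ) x + (f : ℤ → ℂ) (-x)) := rfl

/-- The Darboux operator from the odd to the even sequences, intertwining `h` with `h_B`. -/
def darboux (κ : ℝ) : OneParticle →L[ℂ] OneParticle :=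
  ((1 / 2 : ℂ) • (ContinuousLinearMap.adjoint shift - shift)
    - (κ : ℂ) • diag csign norm_csign_le) ∘L oddProj

theorem darboux_apply (κ : ℝ) (f : OneParticle) (x : ℤ) :
    (darboux κ f : ℤ → ℂ) x
      = 1 / 2 * ((oddProj f : ℤ → ℂ) (x + 1) - (oddProj f : ℤ → ℂ) (x - 1))
        - κ * (csign x * (oddProj f : ℤ → ℂ) x) := by
  change 1 / 2 * ((ContinuousLinearMap.adjoint shift (oddProj f) : ℤ → ℂ) x - _) - _ = _
  rw [adjoint_shift_apply]
  rfl

/-- The adjoint Darboux operator from the even to the odd sequences. -/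
def darbouxAdj (κ : ℝ) : OneParticle →L[ℂ] OneParticle :=
  ((1 / 2 : ℂ) • (shift - ContinuousLinearMap.adjoint shift)
    - (κ : ℂ) • diag csign norm_csign_le) ∘L evenProj

theorem darbouxAdj_apply (κ : ℝ) (f : OneParticle) (x : ℤ) :
    (darbouxAdj κ f : ℤ → ℂ) x
      = 1 / 2 * ((evenProj f : ℤ → ℂ) (x - 1) - (evenProj f : ℤ → ℂ) (x + 1))
        - κ * (csign x * (evenProj f : ℤ → ℂ) x) := by
  change 1 / 2 * (_ - (ContinuousLinearMap.adjoint shift (evenProj f) : ℤ → ℂ) x) - _ = _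
  rw [adjoint_shift_apply]
  rfl

/-- `h` commutes with the reflection, and odd sequences vanish at 0, so the rank one term does not
act on them. -/
theorem oddProj_comp_hXY (κ : ℝ) : oddProj ∘L hXY = hB κ ∘L oddProj := by
  ext f x
  simp only [ContinuousLinearMap.comp_apply, oddProj_apply, hXY_apply, hB_apply]
  split_ifs <;> ring_nf

/-- Away from `-1, 0, 1` the sign is constant on a site and its two neighbours; only these three
sites need a separate check. -/
theorem csign_cases (x : ℤ) : x = 0 ∨ x = 1 ∨ x = -1 ∨
    (1 < x ∧ csign x = 1 ∧ csign (x - 1) = 1 ∧ csign (x + 1) = 1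
      ∧ csign (-x) = -1 ∧ csign (-x - 1) = -1 ∧ csign (-x + 1) = -1) ∨
    (x < -1 ∧ csign x = -1 ∧ csign (x - 1) = -1 ∧ csign (x + 1) = -1
      ∧ csign (-x) = 1 ∧ csign (-x - 1) = 1 ∧ csign (-x + 1) = 1) := by
  have hp : ∀ y : ℤ, 0 < y → csign y = 1 := fun y hy => if_pos hy
  have hn : ∀ y : ℤ, y < 0 → csign y = -1 := fun y hy => by
    rw [csign, if_neg (by omega), if_pos hy]
  rcases lt_trichotomy x 0 with h | h | h
  · rcases eq_or_ne x (-1) with h1 | h1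
    · exact Or.inr (Or.inr (Or.inl h1))
    · refine Or.inr (Or.inr (Or.inr (Or.inr ⟨by omega, ?_⟩)))
      refine ⟨hn _ ?_, hn _ ?_, hn _ ?_, hp _ ?_, hp _ ?_, hp _ ?_⟩ <;> omega
  · exact Or.inl h
  · rcases eq_or_ne x 1 with h1 | h1
    · exact Or.inr (Or.inl h1)
    · refine Or.inr (Or.inr (Or.inr (Or.inl ⟨by omega, ?_⟩)))
      refine ⟨hp _ ?_, hp _ ?_, hp _ ?_, hn _ ?_, hn _ ?_, hn _ ?_⟩ <;> omega

/-- The difference part commutes with `h`. On an odd `g`, where `g(0) = 0`, the sign term fails to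
commute only at the site 0, by `-κ g(1)`; the potential contributes `κ (D g)(0) = κ g(1)` there and
cancels it. -/
theorem darboux_comp_hXY (κ : ℝ) : darboux κ ∘L hXY = hB κ ∘L darboux κ := by
  ext f x
  simp only [ContinuousLinearMap.comp_apply, darboux_apply, oddProj_apply, hXY_apply, hB_apply]
  rcases csign_cases x with rfl | rfl | rfl | ⟨h, h0, h1, h2, -⟩ | ⟨h, h0, h1, h2, -⟩
  · norm_num [csign]
    ring
  · norm_num [csign]
    ring
  · norm_num [csign]
    ring
  · rw [if_neg (by omega), h0, h1, h2]
    ring_nf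
  · rw [if_neg (by omega), h0, h1, h2]
    ring_nf

theorem ofReal_eB_sq (κ : ℝ) : (eB κ : ℂ) ^ 2 = 1 + (κ : ℂ) ^ 2 := by
  rw [← Complex.ofReal_pow, eB, Real.sq_sqrt (by positivity)]
  push_cast
  rfl

/-- The supersymmetric factorization of `h_B² - e_B²` on the even sequences. -/
theorem hB_sq_sub (κ : ℝ) (f : OneParticle) :
    hB κ (hB κ f) - ((eB κ : ℂ) ^ 2) • f
      = oddProj (hB κ (hB κ f) - ((eB κ : ℂ) ^ 2) • f) - darboux κ (darbouxAdj κ f) := by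
  ext x
  rw [ofReal_eB_sq]
  change (hB κ (hB κ f) : ℤ → ℂ) x - (1 + (κ : ℂ) ^ 2) * (f : ℤ → ℂ) x
    = 1 / 2 * (((hB κ (hB κ f) : ℤ → ℂ) x - (1 + (κ : ℂ) ^ 2) * (f : ℤ → ℂ) x)
        - ((hB κ (hB κ f) : ℤ → ℂ) (-x) - (1 + (κ : ℂ) ^ 2) * (f : ℤ → ℂ) (-x)))
      - (darboux κ (darbouxAdj κ f) : ℤ → ℂ) x
  simp only [darboux_apply, oddProj_apply, darbouxAdj_apply, evenProj_apply, hB_apply]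
  rcases csign_cases x with rfl | rfl | rfl | ⟨h, h0, h1, h2, h3, h4, h5⟩ |
    ⟨h, h0, h1, h2, h3, h4, h5⟩
  · norm_num [csign]
    ring
  · norm_num [csign]
    ring
  · norm_num [csign]
    ring
  · have e1 : -(x + 1) = -x - 1 := by ring
    have e2 : -(x - 1) = -x + 1 := by ring
    rw [e1, e2, h0, h1, h2, h3, h4, h5]
    simp only [show x ≠ 0 by omega, show x - 1 ≠ 0 by omega, show x + 1 ≠ 0 by omega,
      show -x ≠ 0 by omega, show -x - 1 ≠ 0 by omega, show -x + 1 ≠ 0 by omega, if_false]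
    ring_nf
  · have e1 : -(x + 1) = -x - 1 := by ring
    have e2 : -(x - 1) = -x + 1 := by ring
    rw [e1, e2, h0, h1, h2, h3, h4, h5]
    simp only [show x ≠ 0 by omega, show x - 1 ≠ 0 by omega, show x + 1 ≠ 0 by omega,
      show -x ≠ 0 by omega, show -x - 1 ≠ 0 by omega, show -x + 1 ≠ 0 by omega, if_false]
    ring_nf

end MagneticXY

/-! ### Decaying solutions of the three-term recursion -/

/-- A solution of the free recursion with parameter in `[-1,1]` that tends to zero vanishes. -/
theorem eq_zero_of_recurrence_of_tendsto {a : ℕ → ℂ} {t : ℝ} (ht : |t| ≤ 1)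
    (ha : Tendsto a atTop (nhds 0)) (h : ∀ n, a (n + 2) + a n = 2 * t * a (n + 1)) (n : ℕ) :
    a n = 0 := by
  -- A conserved quadratic form of the recursion. Decay makes it zero, while for `|t| ≤ 1` it
  -- dominates `(‖a (n + 1)‖ - ‖a n‖) ^ 2`; so `‖a n‖` is constant, and zero in the limit. The band
  -- edges `t = ±1` are included.
  set I : ℕ → ℝ := fun n => Complex.normSq (a (n + 1)) + Complex.normSq (a n)
    - 2 * t * (a (n + 1) * (starRingEnd ℂ) (a n)).re with hI
  have hstep : ∀ n, I (n + 1) = I n := by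
    intro n
    have e : a (n + 2) = 2 * t * a (n + 1) - a n := eq_sub_of_add_eq (h n)
    simp only [hI, e, Complex.normSq_apply, Complex.mul_re, Complex.sub_re, Complex.sub_im,
      Complex.conj_re, Complex.conj_im, Complex.mul_im, Complex.ofReal_re, Complex.ofReal_im,
      Complex.re_ofNat, Complex.im_ofNat]
    ring
  have hconst : ∀ n, I n = I 0 := fun n => by
    induction n with
    | zero => rfl
    | succ n ih => rw [hstep, ih]
  have ha1 : Tendsto (fun n => a (n + 1)) atTop (nhds 0) := (tendsto_add_atTop_iff_nat 1).2 ha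
  have hlim : Tendsto I atTop (nhds 0) := by
    have hc : Continuous fun p : ℂ × ℂ => Complex.normSq p.1 + Complex.normSq p.2
        - 2 * t * (p.1 * (starRingEnd ℂ) p.2).re := by fun_prop
    have := (hc.tendsto (0, 0)).comp (ha1.prodMk_nhds ha)
    simp only [map_zero, mul_zero, Complex.zero_re, add_zero, sub_zero] at this
    exact this
  have hI0 : ∀ n, I n = 0 := by
    have h0 : I 0 = 0 :=
      tendsto_nhds_unique (tendsto_const_nhds.congr fun n => (hconst n).symm) hlim
    exact fun n => (hconst n).trans h0
  have hnorm : ∀ n, ‖a (n + 1)‖ = ‖a n‖ := by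
    intro n
    have h0 := hI0 n
    simp only [hI, Complex.normSq_eq_norm_sq] at h0
    have h1 : t * (a (n + 1) * (starRingEnd ℂ) (a n)).re ≤ ‖a (n + 1)‖ * ‖a n‖ := by
      refine (le_abs_self _).trans ?_
      rw [abs_mul]
      have h2 := Complex.abs_re_le_norm (a (n + 1) * (starRingEnd ℂ) (a n))
      rw [norm_mul, RCLike.norm_conj] at h2
      calc _ ≤ 1 * (‖a (n + 1)‖ * ‖a n‖) := by gcongr
        _ = _ := one_mul _
    have h3 : (‖a (n + 1)‖ - ‖a n‖) ^ 2 ≤ 0 := by nlinarith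
    exact sub_eq_zero.1 (pow_eq_zero_iff two_ne_zero |>.1 (le_antisymm h3 (sq_nonneg _)))
  have hnorm' : ∀ k, ‖a (n + k)‖ = ‖a n‖ := fun k => by
    induction k with
    | zero => rfl
    | succ k ih => rw [← add_assoc, hnorm, ih]
  have hl : Tendsto (fun k => ‖a (n + k)‖) atTop (nhds 0) := by
    have h1 := (tendsto_add_atTop_iff_nat n).2 ha.norm
    simpa [add_comm] using h1
  simp only [hnorm'] at hl
  exact norm_eq_zero.1 (tendsto_nhds_unique tendsto_const_nhds hl)

/-- A solution of the free recursion with hyperbolic parameter that tends to zero is geometric. -/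
theorem eq_geometric_of_recurrence_of_tendsto {a : ℕ → ℂ} {r : ℂ} (hr : 1 < ‖r‖)
    (ha : Tendsto a atTop (nhds 0)) (h : ∀ n, a (n + 2) + a n = (r + r⁻¹) * a (n + 1)) (n : ℕ) :
    a n = r⁻¹ ^ n * a 0 := by
  have hr0 : r ≠ 0 := norm_pos_iff.1 (one_pos.trans hr)
  -- The combination `a n - r * a (n + 1)` isolates the growing mode: it is multiplied by `r` at
  -- each step, so decay forces it to vanish.
  have hd : ∀ n, a (n + 1) - r * a (n + 2) = r * (a n - r * a (n + 1)) := by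
    intro n
    rw [eq_sub_of_add_eq (h n)]
    field_simp
    ring
  have hl : Tendsto (fun n => ‖a n - r * a (n + 1)‖) atTop (nhds 0) := by
    have h1 := (ha.sub (((tendsto_add_atTop_iff_nat 1).2 ha).const_mul r)).norm
    simpa using h1
  have hge : ∀ n k, ‖a n - r * a (n + 1)‖ ≤ ‖a (n + k) - r * a (n + k + 1)‖ := by
    intro n k
    induction k with
    | zero => rfl
    | succ k ih =>
      refine ih.trans ?_
      change _ ≤ ‖a (n + k + 1) - r * a (n + k + 2)‖
      rw [hd, norm_mul]
      exact le_mul_of_one_le_left (norm_nonneg _) hr.le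
  have hz : ∀ n, a n - r * a (n + 1) = 0 := by
    intro n
    have h1 : Tendsto (fun k => ‖a (n + k) - r * a (n + k + 1)‖) atTop (nhds 0) := by
      have h2 := (tendsto_add_atTop_iff_nat n).2 hl
      simpa [add_comm] using h2
    exact norm_le_zero_iff.1 (ge_of_tendsto' h1 (hge n))
  induction n with
  | zero => simp
  | succ n ih =>
    have h1 := sub_eq_zero.1 (hz n)
    rw [pow_succ, mul_right_comm, ← ih, h1]
    field_simp

namespace MagneticXY

/-! ### The doubled Hamiltonian and its absolutely continuous spectrum -/

theorem tendsto_apply_zero (f : OneParticle) {g : ℕ → ℤ} (hg : Function.Injective g) :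
    Tendsto (fun n => (f : ℤ → ℂ) (g n)) atTop (nhds 0) := by
  have hf := (memℓp_gen_iff (p := 2) (by norm_num)).1 (lp.memℓp f)
  have h1 := (hf.comp_injective hg).tendsto_atTop_zero
  rw [tendsto_zero_iff_norm_tendsto_zero]
  have h2 := h1.sqrt
  rw [Real.sqrt_zero] at h2
  refine h2.congr fun n => ?_
  simp [Real.sqrt_sq]

/-- The embedding of `ℓ²(ℤ)` as the first summand. -/
def inl : OneParticle →L[ℂ] Doubled :=
  (WithLp.prodContinuousLinearEquiv 2 ℂ OneParticle OneParticle).symm.toContinuousLinearMap ∘L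
    ContinuousLinearMap.inl ℂ OneParticle OneParticle

/-- The embedding of `ℓ²(ℤ)` as the second summand. -/
def inr : OneParticle →L[ℂ] Doubled :=
  (WithLp.prodContinuousLinearEquiv 2 ℂ OneParticle OneParticle).symm.toContinuousLinearMap ∘L
    ContinuousLinearMap.inr ℂ OneParticle OneParticle

theorem directSum_eq_add (f g : OneParticle) : directSum f g = inl f + inr g := by
  change directSum f g = directSum (f + 0) (0 + g)
  rw [add_zero, zero_add]

theorem directSum_surjective (ψ : Doubled) : ∃ f g, ψ = directSum f g := ⟨ψ.fst, ψ.snd, rfl⟩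

theorem HB_directSum (κ : ℝ) (f g : OneParticle) :
    HB κ (directSum f g) = directSum (hB κ f) (-(hB κ g)) := rfl

theorem inl_comp_hXY {κ : ℝ} {X : OneParticle →L[ℂ] OneParticle}
    (hX : X ∘L hXY = hB κ ∘L X) : (inl ∘L X) ∘L hXY = HB κ ∘L (inl ∘L X) := by
  refine ContinuousLinearMap.ext fun f => ?_
  have h : X (hXY f) = hB κ (X f) := congrArg (fun T => T f) hX
  change inl (X (hXY f)) = HB κ (directSum (X f) 0)
  rw [h, HB_directSum, map_zero, neg_zero]
  rfl

theorem inr_comp_hXY {κ : ℝ} {X : OneParticle →L[ℂ] OneParticle}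
    (hX : X ∘L hXY = hB κ ∘L X) :
    (inr ∘L X ∘L alternate) ∘L hXY = HB κ ∘L (inr ∘L X ∘L alternate) := by
  refine ContinuousLinearMap.ext fun f => ?_
  have h : X (hXY (alternate f)) = hB κ (X (alternate f)) :=
    congrArg (fun T => T (alternate f)) hX
  have h2 : alternate (hXY f) = -(hXY (alternate f)) :=
    congrArg (fun T => T f) alternate_comp_hXY
  change inr (X (alternate (hXY f))) = HB κ (directSum 0 (X (alternate f)))
  rw [h2, map_neg, h, HB_directSum, map_zero]
  rfl

/-- The range of `H_B² - e_B²` is spanned by ranges of operators intertwining `h` with `H_B`. -/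
theorem HB_sq_sub_mem (κ : ℝ) (N : Submodule ℂ Doubled)
    (h : ∀ X : OneParticle →L[ℂ] Doubled, X ∘L hXY = HB κ ∘L X → ∀ φ, X φ ∈ N) (ψ : Doubled) :
    HB κ (HB κ ψ) - ((eB κ : ℂ) ^ 2) • ψ ∈ N := by
  obtain ⟨f, g, rfl⟩ := directSum_surjective ψ
  have e : HB κ (HB κ (directSum f g)) - ((eB κ : ℂ) ^ 2) • directSum f g
      = inl (hB κ (hB κ f) - ((eB κ : ℂ) ^ 2) • f)
        + inr (hB κ (hB κ g) - ((eB κ : ℂ) ^ 2) • g) := by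
    rw [HB_directSum, HB_directSum, map_neg, neg_neg, ← directSum_eq_add]
    rfl
  rw [e, hB_sq_sub κ f, hB_sq_sub κ g, map_sub inl, map_sub inr]
  have hr : ∀ X : OneParticle →L[ℂ] OneParticle, X ∘L hXY = hB κ ∘L X → ∀ φ, inr (X φ) ∈ N := by
    intro X hX φ
    -- The gauge transformation is an involution, so composing with it does not shrink the range of
    -- `X`.
    have := h _ (inr_comp_hXY hX) (alternate φ)
    change inr (X (alternate (alternate φ))) ∈ N at this
    rwa [alternate_alternate] at this
  exact N.add_mem
    (N.sub_mem (h _ (inl_comp_hXY (oddProj_comp_hXY κ)) _)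
      (h _ (inl_comp_hXY (darboux_comp_hXY κ)) _))
    (N.sub_mem (hr _ (oddProj_comp_hXY κ) _) (hr _ (darboux_comp_hXY κ) _))

theorem HB_sq_sub_mem_acSubspace (κ : ℝ) (ψ : Doubled) :
    HB κ (HB κ ψ) - ((eB κ : ℂ) ^ 2) • ψ ∈ acSubspace (HB κ) :=
  apply_apply_sub_mem_acSubspace (isSelfAdjoint_HB κ) isSelfAdjoint_hXY mem_acSubspace_hXY
    (HB_sq_sub_mem κ) ψ

theorem specAC_HB_subset (κ : ℝ) :
    specAC (HB κ) (isSelfAdjoint_HB κ) ⊆ (fun t : ℝ => (t : ℂ)) '' Set.Icc (-1) 1 :=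
  specAC_subset_of_intertwine (isSelfAdjoint_HB κ) isSelfAdjoint_hXY isCompact_Icc
    spectrum_hXY_subset (HB_sq_sub_mem κ)

/-- The right side lives on `±1`, so a solution obeys the free recursion beyond these sites and
vanishes at all `x ≠ 0`. The equations at `1` and `-1` then prescribe opposite nonzero values for
`f(0)`. -/
theorem smul_sub_hB_ne (κ : ℝ) {t : ℝ} (ht : t ∈ Set.Icc (-1 : ℝ) 1) (f : OneParticle) :
    (t : ℂ) • f - hB κ f ≠ oddProj (delta 1) := by
  intro h
  have hx : ∀ x : ℤ, (t : ℂ) * (f : ℤ → ℂ) x - (hB κ f : ℤ → ℂ) x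
      = (oddProj (delta 1) : ℤ → ℂ) x := fun x => congrArg (fun g : OneParticle => (g : ℤ → ℂ) x) h
  simp only [hB_apply, oddProj_apply, delta_apply] at hx
  have h1 : ∀ n : ℕ, (f : ℤ → ℂ) (n + 1) = 0 := by
    refine eq_zero_of_recurrence_of_tendsto (abs_le.2 ht)
      (tendsto_apply_zero f (g := fun n : ℕ => (n : ℤ) + 1) fun a b hab => by simpa using hab)
      fun n => ?_
    have := hx ((n : ℤ) + 2)
    rw [if_neg (by omega), if_neg (by omega), if_neg (by omega)] at this
    push_cast
    ring_nf at this ⊢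
    linear_combination (-2) * this
  have h2 : ∀ n : ℕ, (f : ℤ → ℂ) (-(n + 1)) = 0 := by
    refine eq_zero_of_recurrence_of_tendsto (abs_le.2 ht)
      (tendsto_apply_zero f (g := fun n : ℕ => -((n : ℤ) + 1)) fun a b hab => by simpa using hab)
      fun n => ?_
    have := hx (-((n : ℤ) + 2))
    rw [if_neg (by omega), if_neg (by omega), if_neg (by omega)] at this
    push_cast
    ring_nf at this ⊢
    linear_combination (-2) * this
  have a1 : (f : ℤ → ℂ) 1 = 0 := h1 0
  have a2 : (f : ℤ → ℂ) 2 = 0 := h1 1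
  have b1 : (f : ℤ → ℂ) (-1) = 0 := h2 0
  have b2 : (f : ℤ → ℂ) (-2) = 0 := h2 1
  have c1 := hx 1
  have c2 := hx (-1)
  norm_num at c1 c2
  rw [a1, a2] at c1
  rw [b1, b2] at c2
  have c3 : (1 : ℂ) = 0 := by linear_combination c2 - c1
  exact one_ne_zero c3

theorem subset_specAC_HB (κ : ℝ) :
    (fun t : ℝ => (t : ℂ)) '' Set.Icc (-1) 1 ⊆ specAC (HB κ) (isSelfAdjoint_HB κ) := by
  rintro _ ⟨t, ht, rfl⟩
  refine mem_specAC_of_forall_ne (isSelfAdjoint_HB κ) (ψ := inl (oddProj (delta 1)))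
    (intertwine_mem_acSubspace isSelfAdjoint_hXY (isSelfAdjoint_HB κ)
      (inl_comp_hXY (oddProj_comp_hXY κ)) (mem_acSubspace_hXY (delta 1))) fun φ h => ?_
  exact smul_sub_hB_ne κ ht φ.fst (congrArg WithLp.fst h)

/-! ### Eigenvectors of `h_B` and the bound state -/

theorem one_lt_eB {κ : ℝ} (hκ : 0 < κ) : 1 < eB κ := by
  rw [eB, Real.lt_sqrt zero_le_one]
  nlinarith

theorem eB_sq (κ : ℝ) : eB κ ^ 2 = 1 + κ ^ 2 := Real.sq_sqrt (by positivity)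

theorem lamB_pos {κ : ℝ} (hκ : 0 < κ) : 0 < lamB κ :=
  Real.log_pos (by linarith [one_lt_eB hκ])

theorem inv_add_eB (κ : ℝ) : (κ + eB κ)⁻¹ = eB κ - κ := by
  refine inv_eq_of_mul_eq_one_right ?_
  linear_combination eB_sq κ

/-- The eigenvectors of `h_B` decay geometrically. -/
theorem apply_eq_of_hB_eigenvector {κ : ℝ} {r : ℂ} (hr : 1 < ‖r‖) {f : OneParticle}
    (h : hB κ f = ((r + r⁻¹) / 2) • f) (x : ℤ) :
    (f : ℤ → ℂ) x = r⁻¹ ^ x.natAbs * (f : ℤ → ℂ) 0 := by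
  have hx : ∀ x : ℤ, (hB κ f : ℤ → ℂ) x = (r + r⁻¹) / 2 * (f : ℤ → ℂ) x := fun x =>
    congrArg (fun g : OneParticle => (g : ℤ → ℂ) x) h
  simp only [hB_apply] at hx
  have h1 : ∀ n : ℕ, (f : ℤ → ℂ) n = r⁻¹ ^ n * (f : ℤ → ℂ) 0 := by
    refine eq_geometric_of_recurrence_of_tendsto hr
      (tendsto_apply_zero f (g := fun n : ℕ => (n : ℤ)) Nat.cast_injective) fun n => ?_
    have := hx ((n : ℤ) + 1)
    rw [if_neg (by omega)] at this
    push_cast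
    ring_nf at this ⊢
    linear_combination 2 * this
  have h2 : ∀ n : ℕ, (f : ℤ → ℂ) (-n) = r⁻¹ ^ n * (f : ℤ → ℂ) 0 := by
    refine eq_geometric_of_recurrence_of_tendsto (a := fun n : ℕ => (f : ℤ → ℂ) (-n)) hr
      (tendsto_apply_zero f (g := fun n : ℕ => -(n : ℤ)) fun a b hab => by simpa using hab)
      fun n => ?_
    have := hx (-((n : ℤ) + 1))
    rw [if_neg (by omega)] at this
    push_cast
    ring_nf at this ⊢
    linear_combination 2 * this
  rcases Int.natAbs_eq x with e | e
  · rw [e, Int.natAbs_natCast]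
    exact h1 _
  · rw [e, Int.natAbs_neg, Int.natAbs_natCast]
    exact h2 _

/-- The two geometric half-line solutions must match at the site 0, where the equation reads `(r -
r⁻¹ - 2κ) f(0) = 0`. -/
theorem hB_eigenvector_eq_zero_of_ne {κ : ℝ} {r : ℂ} (hr : 1 < ‖r‖) (hrκ : r - r⁻¹ ≠ 2 * κ)
    {f : OneParticle} (h : hB κ f = ((r + r⁻¹) / 2) • f) : f = 0 := by
  have ha := apply_eq_of_hB_eigenvector hr h
  have h0 : (hB κ f : ℤ → ℂ) 0 = (r + r⁻¹) / 2 * (f : ℤ → ℂ) 0 :=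
    congrArg (fun g : OneParticle => (g : ℤ → ℂ) 0) h
  have a1 : (f : ℤ → ℂ) 1 = r⁻¹ * (f : ℤ → ℂ) 0 := by
    have := ha 1
    rwa [Int.natAbs_one, pow_one] at this
  have b1 : (f : ℤ → ℂ) (-1) = r⁻¹ * (f : ℤ → ℂ) 0 := by
    have := ha (-1)
    rwa [Int.natAbs_neg, Int.natAbs_one, pow_one] at this
  rw [hB_apply, if_pos rfl, zero_sub, zero_add, a1, b1] at h0
  have h1 : (r - r⁻¹ - 2 * κ) * (f : ℤ → ℂ) 0 = 0 := by linear_combination (-2) * h0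
  have h2 := (mul_eq_zero.1 h1).resolve_left (sub_ne_zero.2 hrκ)
  ext x
  rw [ha x, h2, mul_zero]
  rfl

theorem ofReal_add_eB_inv (κ : ℝ) : ((κ + eB κ : ℝ) : ℂ)⁻¹ = eB κ - κ := by
  rw [← Complex.ofReal_inv, inv_add_eB κ]
  push_cast
  rfl

theorem one_lt_norm_add_eB {κ : ℝ} (hκ : 0 < κ) : 1 < ‖((κ + eB κ : ℝ) : ℂ)‖ := by
  have h := one_lt_eB hκ
  rw [Complex.norm_real, Real.norm_eq_abs, abs_of_pos (by linarith)]
  linarith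

theorem hB_eigenvector_neg_eq_zero {κ : ℝ} (hκ : 0 < κ) {f : OneParticle}
    (h : hB κ f = (-(eB κ : ℂ)) • f) : f = 0 := by
  -- This `r` gives the eigenvalue `-e_B` but `r - r⁻¹ = -2κ`, the wrong sign for matching at 0.
  refine hB_eigenvector_eq_zero_of_ne (κ := κ) (r := -((κ + eB κ : ℝ) : ℂ)) ?_ ?_ ?_
  · rw [norm_neg]
    exact one_lt_norm_add_eB hκ
  · rw [inv_neg, ofReal_add_eB_inv κ]
    push_cast
    intro h1
    have h2 : (κ : ℂ) = 0 := by linear_combination (-1 / 4 : ℂ) * h1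
    exact hκ.ne' (by exact_mod_cast h2)
  · rw [h, inv_neg, ofReal_add_eB_inv κ]
    push_cast
    congr 1
    ring

theorem hB_eigenvector_apply {κ : ℝ} (hκ : 0 < κ) {f : OneParticle}
    (h : hB κ f = (eB κ : ℂ) • f) (x : ℤ) :
    (f : ℤ → ℂ) x = ((eB κ - κ : ℝ) : ℂ) ^ x.natAbs * (f : ℤ → ℂ) 0 := by
  have h1 := apply_eq_of_hB_eigenvector (κ := κ) (one_lt_norm_add_eB hκ) (f := f) (by
    rw [h, ofReal_add_eB_inv κ]
    push_cast
    congr 1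
    ring) x
  rw [ofReal_add_eB_inv κ] at h1
  rw [h1]
  push_cast
  rfl

theorem exp_neg_lamB_mul_abs {κ : ℝ} (hκ : 0 < κ) (x : ℤ) :
    Real.exp (-(lamB κ) * |(x : ℝ)|) = (eB κ - κ) ^ x.natAbs := by
  have h := one_lt_eB hκ
  rw [← inv_add_eB κ, ← Int.cast_abs, Int.abs_eq_natAbs, Int.cast_natCast, mul_comm,
    Real.exp_nat_mul, Real.exp_neg, lamB, Real.exp_log (by linarith)]

theorem hasSum_pow_natAbs {q : ℝ} (hq0 : 0 ≤ q) (hq : q < 1) :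
    HasSum (fun x : ℤ => q ^ x.natAbs) ((1 + q) / (1 - q)) := by
  have h1 : HasSum (fun n : ℕ => q ^ (n : ℤ).natAbs) (1 - q)⁻¹ := by
    simpa using hasSum_geometric_of_lt_one hq0 hq
  -- The negative half-line starts at `-1`, so that 0 is counted once.
  have h2 : HasSum (fun n : ℕ => q ^ (-((n : ℤ) + 1)).natAbs) (q * (1 - q)⁻¹) := by
    have e : (fun n : ℕ => q ^ (-((n : ℤ) + 1)).natAbs) = fun n => q * q ^ n := funext fun n => by
      rw [Int.natAbs_neg, show ((n : ℤ) + 1).natAbs = n + 1 by omega, pow_succ']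
    rw [e]
    exact (hasSum_geometric_of_lt_one hq0 hq).mul_left q
  have e : (1 + q) / (1 - q) = (1 - q)⁻¹ + q * (1 - q)⁻¹ := by ring
  rw [e]
  exact HasSum.of_nat_of_neg_add_one h1 h2

theorem hasSum_norm_sq_fB {κ : ℝ} (hκ : 0 < κ) :
    HasSum (fun x : ℤ => ‖(((nB κ)⁻¹ * Real.exp (-(lamB κ) * |(x : ℝ)|) : ℝ) : ℂ)‖ ^ (2 : ℝ)) 1 := by
  have h := one_lt_eB hκ
  have hsq := eB_sq κ
  have hs0 : 0 < eB κ - κ := by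
    rw [← inv_add_eB κ]
    exact inv_pos.2 (by linarith)
  have hs1 : eB κ - κ < 1 := by nlinarith
  have hn : nB κ ^ 2 = eB κ / κ := Real.sq_sqrt (by positivity)
  have h1 := (hasSum_pow_natAbs (sq_nonneg (eB κ - κ)) (by nlinarith)).mul_left ((nB κ ^ 2)⁻¹)
  have e1 : (fun x : ℤ => ‖(((nB κ)⁻¹ * Real.exp (-(lamB κ) * |(x : ℝ)|) : ℝ) : ℂ)‖ ^ (2 : ℝ))
      = fun x : ℤ => (nB κ ^ 2)⁻¹ * ((eB κ - κ) ^ 2) ^ x.natAbs := by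
    funext x
    rw [exp_neg_lamB_mul_abs hκ, Complex.norm_real, Real.rpow_two, Real.norm_eq_abs, sq_abs,
      mul_pow, inv_pow, ← pow_mul, ← pow_mul, mul_comm 2]
  -- With `s = e_B - κ` one has `1 - s² = 2κs` and `1 + s² = 2e_B s`, so the geometric sum is `e_B /
  -- κ`, which is `n_B²`.
  have e2 : (nB κ ^ 2)⁻¹ * ((1 + (eB κ - κ) ^ 2) / (1 - (eB κ - κ) ^ 2)) = 1 := by
    have h2 : 1 - (eB κ - κ) ^ 2 = 2 * κ * (eB κ - κ) := by linear_combination (-1) * hsq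
    have h3 : 1 + (eB κ - κ) ^ 2 = 2 * eB κ * (eB κ - κ) := by linear_combination (-1) * hsq
    rw [hn, h2, h3]
    field_simp
  rw [e1, ← e2]
  exact h1

/-- The normalized eigenvector `f_B` of `h_B`. -/
def boundState {κ : ℝ} (hκ : 0 < κ) : OneParticle :=
  ⟨fun x : ℤ => (((nB κ)⁻¹ * Real.exp (-(lamB κ) * |(x : ℝ)|) : ℝ) : ℂ),
    memℓp_gen (by simpa using (hasSum_norm_sq_fB hκ).summable)⟩

theorem boundState_apply {κ : ℝ} (hκ : 0 < κ) (x : ℤ) : (boundState hκ : ℤ → ℂ) x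
    = (((nB κ)⁻¹ * Real.exp (-(lamB κ) * |(x : ℝ)|) : ℝ) : ℂ) := rfl

theorem norm_boundState {κ : ℝ} (hκ : 0 < κ) : ‖boundState hκ‖ = 1 := by
  have h := lp.norm_rpow_eq_tsum (p := 2) (by norm_num) (boundState hκ)
  simp only [boundState_apply, ENNReal.toReal_ofNat] at h
  rw [(hasSum_norm_sq_fB hκ).tsum_eq, Real.rpow_two] at h
  exact (pow_eq_one_iff_of_nonneg (norm_nonneg _) two_ne_zero).1 h

theorem hB_boundState {κ : ℝ} (hκ : 0 < κ) :
    hB κ (boundState hκ) = (eB κ : ℂ) • boundState hκ := by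
  have hs : ∀ x : ℤ, (boundState hκ : ℤ → ℂ) x
      = ((nB κ)⁻¹ : ℂ) * ((eB κ - κ : ℂ)) ^ x.natAbs := fun x => by
    rw [boundState_apply, exp_neg_lamB_mul_abs hκ]
    push_cast
    rfl
  -- The characteristic equation of the recursion for the decay factor `e_B - κ`; it settles every
  -- site except 0.
  have hsq : (eB κ - κ : ℂ) ^ 2 + 1 = 2 * eB κ * (eB κ - κ) := by
    linear_combination (-1 : ℂ) * ofReal_eB_sq κ
  ext x
  change (hB κ (boundState hκ) : ℤ → ℂ) x = (eB κ : ℂ) * (boundState hκ : ℤ → ℂ) x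
  rw [hB_apply]
  simp only [hs]
  obtain ⟨n, rfl | rfl⟩ := x.eq_nat_or_neg
  · rcases n with _ | n
    · simp
      ring
    · rw [if_neg (by omega), show (((n + 1 : ℕ) : ℤ) - 1).natAbs = n by omega,
        show (((n + 1 : ℕ) : ℤ) + 1).natAbs = n + 2 by omega, Int.natAbs_natCast]
      linear_combination (1 / 2 * ((nB κ)⁻¹ : ℂ) * (eB κ - κ : ℂ) ^ n) * hsq
  · rcases n with _ | n
    · simp
      ring
    · rw [if_neg (by omega), show (-((n + 1 : ℕ) : ℤ) - 1).natAbs = n + 2 by omega,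
        show (-((n + 1 : ℕ) : ℤ) + 1).natAbs = n by omega, Int.natAbs_neg, Int.natAbs_natCast]
      linear_combination (1 / 2 * ((nB κ)⁻¹ : ℂ) * (eB κ - κ : ℂ) ^ n) * hsq

theorem hB_eigenvector_mem_span {κ : ℝ} (hκ : 0 < κ) {f : OneParticle}
    (h : hB κ f = (eB κ : ℂ) • f) : ∃ c : ℂ, c • boundState hκ = f := by
  refine ⟨nB κ * (f : ℤ → ℂ) 0, ?_⟩
  have hn : (nB κ : ℂ) ≠ 0 := by
    have := one_lt_eB hκ
    exact Complex.ofReal_ne_zero.2 (Real.sqrt_pos.2 (by positivity)).ne'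
  ext x
  change (nB κ : ℂ) * (f : ℤ → ℂ) 0 * (boundState hκ : ℤ → ℂ) x = _
  rw [hB_eigenvector_apply hκ h x, boundState_apply, exp_neg_lamB_mul_abs hκ]
  push_cast
  field_simp

/-! ### Eigenvalues and eigenspaces of `H_B` -/

theorem norm_directSum_left (f : OneParticle) : ‖directSum f 0‖ = ‖f‖ := by
  simp [directSum]

theorem norm_directSum_right (f : OneParticle) : ‖directSum 0 f‖ = ‖f‖ := by
  simp [directSum]

theorem hasEigenvector_left {κ : ℝ} (hκ : 0 < κ) :
    Module.End.HasEigenvector (HB κ : Doubled →ₗ[ℂ] Doubled) (eB κ : ℂ)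
      (directSum (boundState hκ) 0) := by
  refine ⟨Module.End.mem_eigenspace_iff.2 ?_, fun h => ?_⟩
  · change HB κ (directSum (boundState hκ) 0) = _
    rw [HB_directSum, hB_boundState, map_zero, neg_zero]
    exact congrArg (directSum _) (smul_zero _).symm
  · have := norm_directSum_left (boundState hκ)
    rw [h, norm_zero, norm_boundState] at this
    exact zero_ne_one this

theorem hasEigenvector_right {κ : ℝ} (hκ : 0 < κ) :
    Module.End.HasEigenvector (HB κ : Doubled →ₗ[ℂ] Doubled) (-(eB κ : ℂ))
      (directSum 0 (boundState hκ)) := by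
  refine ⟨Module.End.mem_eigenspace_iff.2 ?_, fun h => ?_⟩
  · change HB κ (directSum 0 (boundState hκ)) = _
    rw [HB_directSum, hB_boundState, map_zero, ← neg_smul]
    exact congrArg (fun g => directSum g _) (smul_zero _).symm
  · have := norm_directSum_right (boundState hκ)
    rw [h, norm_zero, norm_boundState] at this
    exact zero_ne_one this

/-- Simplicity in the direct sum needs two facts: the `e_B`-eigenspace of `h_B` is a line, and
`-e_B` is not an eigenvalue of `h_B`, so the second component vanishes. -/
theorem finrank_eigenspace_left {κ : ℝ} (hκ : 0 < κ) :
    Module.finrank ℂ (Module.End.eigenspace (HB κ : Doubled →ₗ[ℂ] Doubled) (eB κ : ℂ)) = 1 := by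
  have hv := hasEigenvector_left hκ
  refine (finrank_eq_one_iff_of_nonzero' (⟨_, hv.1⟩ : Module.End.eigenspace _ _)
    fun h => hv.2 (congrArg Subtype.val h)).2 ?_
  rintro ⟨w, hw⟩
  obtain ⟨f, g, rfl⟩ := directSum_surjective w
  have h1 : HB κ (directSum f g) = (eB κ : ℂ) • directSum f g := Module.End.mem_eigenspace_iff.1 hw
  have hf : hB κ f = (eB κ : ℂ) • f := congrArg WithLp.fst h1
  have hg : -(hB κ g) = (eB κ : ℂ) • g := congrArg WithLp.snd h1
  have hg0 : g = 0 := hB_eigenvector_neg_eq_zero hκ (by rw [neg_smul, ← hg, neg_neg])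
  obtain ⟨c, hc⟩ := hB_eigenvector_mem_span hκ hf
  refine ⟨c, Subtype.ext ?_⟩
  change directSum (c • boundState hκ) (c • 0) = directSum f g
  rw [hc, hg0, smul_zero]

theorem finrank_eigenspace_right {κ : ℝ} (hκ : 0 < κ) :
    Module.finrank ℂ (Module.End.eigenspace (HB κ : Doubled →ₗ[ℂ] Doubled) (-(eB κ : ℂ))) = 1 := by
  have hv := hasEigenvector_right hκ
  refine (finrank_eq_one_iff_of_nonzero' (⟨_, hv.1⟩ : Module.End.eigenspace _ _)
    fun h => hv.2 (congrArg Subtype.val h)).2 ?_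
  rintro ⟨w, hw⟩
  obtain ⟨f, g, rfl⟩ := directSum_surjective w
  have h1 : HB κ (directSum f g) = (-(eB κ : ℂ)) • directSum f g :=
    Module.End.mem_eigenspace_iff.1 hw
  have hf : hB κ f = (-(eB κ : ℂ)) • f := congrArg WithLp.fst h1
  have hg : -(hB κ g) = (-(eB κ : ℂ)) • g := congrArg WithLp.snd h1
  have hf0 : f = 0 := hB_eigenvector_neg_eq_zero hκ hf
  rw [neg_smul, neg_inj] at hg
  obtain ⟨c, hc⟩ := hB_eigenvector_mem_span hκ hg
  refine ⟨c, Subtype.ext ?_⟩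
  change directSum (c • 0) (c • boundState hκ) = directSum f g
  rw [hc, hf0, smul_zero]

theorem specPP_HB {κ : ℝ} (hκ : 0 < κ) : specPP (HB κ) = {(eB κ : ℂ), -(eB κ : ℂ)} := by
  ext z
  refine ⟨fun hz => ?_, ?_⟩
  · obtain ⟨ψ, hψ⟩ := Module.End.HasEigenvalue.exists_hasEigenvector hz
    exact sq_eq_sq_iff_eq_or_eq_neg.1 (eigenvalue_sq_eq (isSelfAdjoint_HB κ)
      (HB_sq_sub_mem_acSubspace κ) hψ.2 hψ.apply_eq_smul)
  · rintro (rfl | rfl)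
    · exact Module.End.hasEigenvalue_of_hasEigenvector (hasEigenvector_left hκ)
    · exact Module.End.hasEigenvalue_of_hasEigenvector (hasEigenvector_right hκ)

end MagneticXY

end

open SpectralTypes MagneticXY
theorem theoremB (κ : ℝ) (hκ : 0 < κ) :
    specSC (HB κ) (isSelfAdjoint_HB κ) = ∅ ∧
    specAC (HB κ) (isSelfAdjoint_HB κ) = (fun t : ℝ => (t : ℂ)) '' Set.Icc (-1) 1 ∧
    specPP (HB κ) = {(eB κ : ℂ), -(eB κ : ℂ)} ∧
    1 < eB κ ∧
    0 < lamB κ ∧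
    Module.finrank ℂ (Module.End.eigenspace (HB κ : Doubled →ₗ[ℂ] Doubled) (eB κ : ℂ)) = 1 ∧
    Module.finrank ℂ (Module.End.eigenspace (HB κ : Doubled →ₗ[ℂ] Doubled) (-(eB κ : ℂ))) = 1 ∧
    ∃ fB : OneParticle,
      (∀ x : ℤ, (fB : ℤ → ℂ) x = (((nB κ)⁻¹ * Real.exp (-(lamB κ) * |(x : ℝ)|) : ℝ) : ℂ)) ∧
      ‖directSum fB 0‖ = 1 ∧
      ‖directSum 0 fB‖ = 1 ∧
      Module.End.HasEigenvector (HB κ : Doubled →ₗ[ℂ] Doubled) (eB κ : ℂ) (directSum fB 0) ∧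
      Module.End.HasEigenvector (HB κ : Doubled →ₗ[ℂ] Doubled) (-(eB κ : ℂ))
        (directSum 0 fB) :=
  ⟨specSC_eq_empty _ (HB_sq_sub_mem_acSubspace κ),
    (specAC_HB_subset κ).antisymm (subset_specAC_HB κ), specPP_HB hκ, one_lt_eB hκ, lamB_pos hκ,
    finrank_eigenspace_left hκ, finrank_eigenspace_right hκ, boundState hκ, boundState_apply hκ,
    (norm_directSum_left _).trans (norm_boundState hκ),
    (norm_directSum_right _).trans (norm_boundState hκ),
    hasEigenvector_left hκ, hasEigenvector_right hκ⟩
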